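/- Fix an integer $d\ge 1$, real numbers $\alpha>0$, $0<\gamma\le d$, $0<r<\infty$ and $s_*>0$. For $f\in L^2(\mathbb R^d)$ with compactly supported Fourier transform $\widehat f(\xi)=\int e^{-ix\cdot\xi}f(x)\,dx$ (understood in the $L^2$ sense) write $$e^{it(-\Delta)^{\alpha/2}}f(x)=(2\pi)^{-d}\int_{\mathbb R^d}e^{i(x\cdot\xi+t|\xi|^\alpha)}\widehat f(\xi)\,d\xi ,\qquad x\in\mathbb R^d,\ t\in\mathbb R,$$ and let $\mathbb A_R=\{\xi\in\mathbb R^d: R\le|\xi|\le 2R\}$ and $B(x,\rho)=\{y\in\mathbb R^d:|x-y|<\rho\}$. A nonnegative Borel measure $\mu$ on $\mathbb R^d$ is called $\gamma$-dimensional if there is a constant $C_\mu<\infty$ with $\mu(B(x,\rho))\le C_\mu\rho^\gamma$ for all $x\in\mathbb R^d$ and $\rho>0$; the infimum of such constants $C_\mu \geq 0$ is denoted by $\langle\mu\rangle_\gamma$. Suppose that there is a constant $C_0>0$ such that $$\Big\|\sup_{0<t\le1}|e^{it(-\Delta)^{\alpha/2}}f|\Big\|_{L^2(B(0,1),d\mu)}\le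 C_0\,R^{\frac{d-\gamma}2+s_*}\langle\mu\rangle_\gamma^{1/2}\|f\|_{L^2(\mathbb R^d)}$$ for all $R\ge1$, all $\gamma$-dimensional measures $\mu$ on $\mathbb R^d$ and all $f\in L^2(\mathbb R^d)$ with $\operatorname{supp}\widehat f\subset\mathbb A_R$. Let $$\tilde s_*=\frac{r\alpha}{r\min\{\alpha,1\}+2s_*}\,s_* .$$ Then, for every real sequence $\{t_n\}_{n\in\mathbb N}$ in $\ell^{r,\infty}(\mathbb N)$, that is, with $\sup_{\delta>0}\delta^r\,\#\{n\in\mathbb N:|t_n|\ge\delta\}<\infty$, there is a constant $C>0$ such that $$\Big\|\sup_{n}|e^{it_n(-\Delta)^{\alpha/2}}f|\Big\|_{L^2(B(0,1),d\mu)}\le C\,R^{\frac{d-\gamma}2+s}\langle\mu\rangle_\gamma^{1/2}\|f\|_{L^2(\mathbb R^d)}$$ for all $s\ge\min\{s_*,\tilde s_*\}$, all $R\ge1$, all $\gamma$-dimensional measures $\mu$ on $\mathbb R^d$ and all $f\in L^2(\mathbb R^d)$ with $\operatorname{supp}\widehat f\subset\mathbb A_R$. -/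

import Mathlib

open MeasureTheory Metric
open scoped ENNReal NNReal FourierTransform

noncomputable section

/-- The space `L²(ℝ^d)` of complex-valued functions (Lebesgue measure). -/
abbrev L2Space (d : ℕ) : Type :=
  Lp ℂ 2 (volume : Measure (EuclideanSpace ℝ (Fin d)))

/-- The Fourier transform on `L²(ℝ^d)` normalized as `f̂(ξ) = ∫ e^{-i x·ξ} f(x) dx`.
Mathlib's `𝓕` on `L²` has the kernel `e^{-2πi x·ξ}`, hence the rescaling of the variable by
`(2π)⁻¹`. As usual for `L²`, it is determined up to almost everywhere equality. -/
def fourierHat {d : ℕ} (f : L2Space d) (ξ : EuclideanSpace ℝ (Fin d)) : ℂ :=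
  (𝓕 f : L2Space d) ((2 * Real.pi)⁻¹ • ξ)

/-- `e^{it(-Δ)^{α/2}} f (x) = (2π)^{-d} ∫ e^{i(x·ξ + t|ξ|^α)} f̂(ξ) dξ`, at every point `x`.
For `f ∈ L²` with compactly supported Fourier transform the integral converges absolutely. -/
def schrodinger {d : ℕ} (α t : ℝ) (f : L2Space d) (x : EuclideanSpace ℝ (Fin d)) : ℂ :=
  (((2 * Real.pi) ^ d)⁻¹ : ℝ) *
    ∫ ξ : EuclideanSpace ℝ (Fin d),
      Complex.exp (Complex.I * ((inner ℝ x ξ + t * ‖ξ‖ ^ α : ℝ) : ℂ)) * fourierHat f ξ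

/-- The annulus `A_R = {ξ : R ≤ |ξ| ≤ 2R}`. -/
def annulus (d : ℕ) (R : ℝ) : Set (EuclideanSpace ℝ (Fin d)) :=
  {ξ | R ≤ ‖ξ‖ ∧ ‖ξ‖ ≤ 2 * R}

/-- The Fourier transform of `f` is supported in the (closed) annulus `A_R`, that is, it vanishes
almost everywhere off `A_R`. -/
def FourierSupportedIn {d : ℕ} (f : L2Space d) (R : ℝ) : Prop :=
  ∀ᵐ ξ : EuclideanSpace ℝ (Fin d), ξ ∉ annulus d R → fourierHat f ξ = 0

/-- The constants `C ≥ 0` such that `μ(B(x,ρ)) ≤ C ρ^γ` for all `x ∈ ℝ^d` and `ρ > 0`. -/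
def ballConstants {d : ℕ} (γ : ℝ) (μ : Measure (EuclideanSpace ℝ (Fin d))) : Set ℝ :=
  {C | 0 ≤ C ∧ ∀ (x : EuclideanSpace ℝ (Fin d)) (ρ : ℝ), 0 < ρ →
    μ (ball x ρ) ≤ ENNReal.ofReal (C * ρ ^ γ)}

/-- The Borel measure `μ` on `ℝ^d` is `γ`-dimensional. -/
def IsDimensional {d : ℕ} (γ : ℝ) (μ : Measure (EuclideanSpace ℝ (Fin d))) : Prop :=
  (ballConstants γ μ).Nonempty

/-- `⟨μ⟩_γ`, the infimum of the admissible constants. -/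
def dimConst {d : ℕ} (γ : ℝ) (μ : Measure (EuclideanSpace ℝ (Fin d))) : ℝ :=
  sInf (ballConstants γ μ)

/-- The `L²(B(0,1), dμ)` norm of `x ↦ sup_{i} |e^{i t_i (-Δ)^{α/2}} f (x)|`, the supremum being
taken over a family of times, with values in `[0, ∞]`. -/
def maximalNorm {d : ℕ} {ι : Type} (α : ℝ) (t : ι → ℝ) (f : L2Space d)
    (μ : Measure (EuclideanSpace ℝ (Fin d))) : ℝ≥0∞ :=
  eLpNorm (fun x => ⨆ i, ‖schrodinger α (t i) f x‖ₑ) 2 (μ.restrict (ball 0 1))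

/-- `t ∈ ℓ^{r,∞}(ℕ)`: `sup_{δ>0} δ^r #{n : |t_n| ≥ δ} < ∞`. -/
def MemWeakEll (r : ℝ) (t : ℕ → ℝ) : Prop :=
  ⨆ (δ : ℝ) (_ : 0 < δ), ENNReal.ofReal (δ ^ r) * (({n : ℕ | δ ≤ |t n|}.encard : ℕ∞) : ℝ≥0∞) < ⊤

end

/-! Rescaling frequency `R` to frequency one turns the hypothesis into `LocalMaximalBound`: on every
ball of radius `N ≥ 1` and over times up to `N ^ α`, the maximal function costs `N ^ (2 * s)` in
squared `L²` norm, where `s` is $s_*$. The rescaled sequence is `R ^ α * t n`.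

A wave of unit frequency has bounded speed, so for times at most `min N (N ^ α)` its values on a
ball of radius `N` depend essentially only on the data near that ball. To make this precise, write
`f = w⁻¹ (w f)` with a polynomially decaying weight `w` adapted to the ball. On the Fourier side
`w⁻¹` is a differential operator. It maps a localized plane wave to a finite sum of such waves with
bounded coefficients (`IsWaveSum.shiftedDeriv`), so the local bound applies to `w f`
(`exists_weightedBound`). Averaging over the centre of the ball removes the spatial localization
(`exists_globalBound`).

Take `N = R ^ κ`. The terms with `|R ^ α * t n| ≤ N ^ min α 1` are controlled together at cost `R ^
(2 * κ * s)`. Each remaining term costs `O(1)`, and the weak `ℓ^r` condition bounds their number by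
a constant times `R ^ (2 * κ * s)` exactly when `κ = r * α / (r * min α 1 + 2 * s)`. This is
`exists_sequenceBound_of_weakEll`. The exponent $s_*$ itself only needs the sequence to be bounded:
finitely many translates of the full time interval cover it. -/

/-- The oscillating factor `e^{i(2π x·ζ + t|ζ|^α)}`. -/
noncomputable def planeWave {d : ℕ} (α : ℝ) (x : EuclideanSpace ℝ (Fin d)) (t : ℝ)
    (ζ : EuclideanSpace ℝ (Fin d)) : ℂ :=
  Complex.exp (Complex.I * ((2 * Real.pi * inner ℝ x ζ + t * ‖ζ‖ ^ α : ℝ) : ℂ))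

/-- The extension operator `g ↦ ∫ e^{i(2π x·ζ + t|ζ|^α)} g(ζ) dζ`. -/
noncomputable def extension {d : ℕ} (α : ℝ) (g : EuclideanSpace ℝ (Fin d) → ℂ)
    (x : EuclideanSpace ℝ (Fin d)) (t : ℝ) : ℂ :=
  ∫ ζ, planeWave α x t ζ * g ζ

/-- `∫ sup_{t ∈ T} |extension g|² dμ`. -/
noncomputable def maximalSq {d : ℕ} (α : ℝ) (T : Set ℝ) (g : EuclideanSpace ℝ (Fin d) → ℂ)
    (μ : Measure (EuclideanSpace ℝ (Fin d))) : ℝ≥0∞ :=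
  ∫⁻ x, (⨆ t ∈ T, ‖extension α g x t‖ₑ) ^ 2 ∂μ

/-- The square of the `L²` norm. -/
noncomputable def sqNorm {d : ℕ} (g : EuclideanSpace ℝ (Fin d) → ℂ) : ℝ≥0∞ :=
  ∫⁻ ζ, ‖g ζ‖ₑ ^ 2

/-! ### Elementary properties of the extension operator and its maximal function. -/

section Basic

variable {d : ℕ} {α : ℝ}

lemma norm_planeWave (x : EuclideanSpace ℝ (Fin d)) (t : ℝ) (ζ : EuclideanSpace ℝ (Fin d)) :
    ‖planeWave α x t ζ‖ = 1 := by
  rw [planeWave, mul_comm, Complex.norm_exp_ofReal_mul_I]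

lemma planeWave_add (x y : EuclideanSpace ℝ (Fin d)) (t s : ℝ) (ζ : EuclideanSpace ℝ (Fin d)) :
    planeWave α (x + y) (t + s) ζ = planeWave α x t ζ * planeWave α y s ζ := by
  simp only [planeWave, ← Complex.exp_add, inner_add_left]
  congr 1
  push_cast
  ring

lemma continuous_planeWave (hα : 0 < α) (x : EuclideanSpace ℝ (Fin d)) (t : ℝ) :
    Continuous (planeWave α x t) := by
  unfold planeWave
  have : Continuous fun ζ : EuclideanSpace ℝ (Fin d) => ‖ζ‖ ^ α :=
    continuous_norm.rpow_const fun _ => Or.inr hα.le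
  fun_prop

lemma continuous_planeWave_left (t : ℝ) (ζ : EuclideanSpace ℝ (Fin d)) :
    Continuous fun x => planeWave α x t ζ := by
  unfold planeWave
  fun_prop

lemma sqNorm_planeWave_mul (x : EuclideanSpace ℝ (Fin d)) (t : ℝ)
    (g : EuclideanSpace ℝ (Fin d) → ℂ) :
    sqNorm (fun ζ => planeWave α x t ζ * g ζ) = sqNorm g := by
  unfold sqNorm
  refine lintegral_congr fun ζ => ?_
  rw [enorm_mul, ← ofReal_norm, norm_planeWave, ENNReal.ofReal_one, one_mul]

lemma memLp_planeWave_mul (hα : 0 < α) (x : EuclideanSpace ℝ (Fin d)) (t : ℝ)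
    {g : EuclideanSpace ℝ (Fin d) → ℂ} {p : ℝ≥0∞} (hg : MemLp g p volume) :
    MemLp (fun ζ => planeWave α x t ζ * g ζ) p volume := by
  refine hg.of_le (((continuous_planeWave hα x t).aestronglyMeasurable).mul hg.1) ?_
  filter_upwards with ζ
  rw [norm_mul, norm_planeWave, one_mul]

lemma extension_planeWave_mul (y : EuclideanSpace ℝ (Fin d)) (s : ℝ)
    (g : EuclideanSpace ℝ (Fin d) → ℂ) (x : EuclideanSpace ℝ (Fin d)) (t : ℝ) :
    extension α (fun ζ => planeWave α y s ζ * g ζ) x t = extension α g (x + y) (t + s) := by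
  unfold extension
  simp only [planeWave_add, mul_assoc]

lemma integrable_of_vanish_off_annulus {g : EuclideanSpace ℝ (Fin d) → ℂ} {l : ℝ}
    (hg : MemLp g 2 volume) (hl : ∀ ζ, ζ ∉ annulus d l → g ζ = 0) : Integrable g := by
  have h1 : IntegrableOn g (closedBall 0 (2 * l)) := by
    have : IsFiniteMeasure (volume.restrict (closedBall (0 : EuclideanSpace ℝ (Fin d)) (2 * l))) :=
      ⟨by simpa using measure_closedBall_lt_top⟩
    exact (hg.restrict (closedBall 0 (2 * l))).integrable (by norm_num)
  rw [integrableOn_iff_integrable_of_support_subset] at h1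
  · exact h1
  · intro ζ hζ
    by_contra hc
    refine hζ (hl ζ fun h => hc ?_)
    simpa using h.2

lemma continuous_extension (hα : 0 < α) {g : EuclideanSpace ℝ (Fin d) → ℂ} (hg : Integrable g)
    (t : ℝ) : Continuous fun x => extension α g x t := by
  unfold extension
  refine continuous_of_dominated (bound := fun ζ => ‖g ζ‖) ?_ ?_ hg.norm ?_
  · exact fun x => ((continuous_planeWave hα x t).aestronglyMeasurable).mul hg.1
  · intro x
    filter_upwards with ζ
    rw [norm_mul, norm_planeWave, one_mul]
  · filter_upwards with ζ
    exact (continuous_planeWave_left t ζ).mul continuous_const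

/-- `T` may be uncountable, but a supremum of functions continuous in `x` is lower semicontinuous.
-/
lemma measurable_iSup_extension (hα : 0 < α) {g : EuclideanSpace ℝ (Fin d) → ℂ}
    (hg : Integrable g) (T : Set ℝ) :
    Measurable fun x => (⨆ t ∈ T, ‖extension α g x t‖ₑ) ^ 2 := by
  refine Measurable.pow_const (LowerSemicontinuous.measurable ?_) 2
  refine lowerSemicontinuous_iSup fun t => lowerSemicontinuous_iSup fun _ => ?_
  exact (continuous_extension hα hg t).enorm.lowerSemicontinuous

lemma maximalSq_mono {T T' : Set ℝ} {g : EuclideanSpace ℝ (Fin d) → ℂ}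
    {μ μ' : Measure (EuclideanSpace ℝ (Fin d))} (hT : T ⊆ T') (hμ : μ ≤ μ') :
    maximalSq α T g μ ≤ maximalSq α T' g μ' := by
  refine lintegral_mono' hμ fun x => ?_
  exact pow_le_pow_left' (biSup_mono fun t ht => hT ht) 2

lemma maximalSq_iUnion_le (hα : 0 < α) {ι : Type*} (F : Finset ι) (T : ι → Set ℝ)
    {g : EuclideanSpace ℝ (Fin d) → ℂ} (hg : Integrable g)
    (μ : Measure (EuclideanSpace ℝ (Fin d))) :
    maximalSq α (⋃ i ∈ F, T i) g μ ≤ ∑ i ∈ F, maximalSq α (T i) g μ := by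
  unfold maximalSq
  rw [← lintegral_finsetSum _ fun i _ => measurable_iSup_extension hα hg (T i)]
  refine lintegral_mono fun x => ?_
  rw [← ENNReal.rpow_two]
  refine (ENNReal.rpow_le_rpow (iSup₂_le fun t ht => ?_) zero_le_two).trans_eq
    (b := ((∑ i ∈ F, (⨆ t ∈ T i, ‖extension α g x t‖ₑ) ^ 2) ^ ((1 : ℝ) / 2)) ^ (2 : ℝ)) ?_
  · simp only [Set.mem_iUnion] at ht
    obtain ⟨i, hi, ht⟩ := ht
    have h1 : ‖extension α g x t‖ₑ ^ 2 ≤ ∑ i ∈ F, (⨆ t ∈ T i, ‖extension α g x t‖ₑ) ^ 2 :=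
      (pow_le_pow_left' (le_biSup (fun t => ‖extension α g x t‖ₑ) ht) 2).trans
        (Finset.single_le_sum (f := fun i => (⨆ t ∈ T i, ‖extension α g x t‖ₑ) ^ 2)
          (fun _ _ => zero_le) hi)
    refine le_of_eq_of_le ?_ (ENNReal.rpow_le_rpow h1 (by norm_num : (0 : ℝ) ≤ 1 / 2))
    rw [← ENNReal.rpow_natCast, ← ENNReal.rpow_mul]
    norm_num
  · rw [← ENNReal.rpow_mul]
    norm_num

/-- Shifting time multiplies the data by a unimodular factor, so every time interval of a given
length obeys the same bound. -/
lemma maximalSq_translate_time (T : Set ℝ) (s : ℝ) (g : EuclideanSpace ℝ (Fin d) → ℂ)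
    (μ : Measure (EuclideanSpace ℝ (Fin d))) :
    maximalSq α T (fun ζ => planeWave α 0 s ζ * g ζ) μ = maximalSq α ((· + s) '' T) g μ := by
  unfold maximalSq
  refine lintegral_congr fun x => ?_
  rw [iSup_image]
  simp only [extension_planeWave_mul, add_zero]

lemma extension_add (hα : 0 < α) {g h : EuclideanSpace ℝ (Fin d) → ℂ} (hg : Integrable g)
    (hh : Integrable h) (x : EuclideanSpace ℝ (Fin d)) (t : ℝ) :
    extension α (fun ζ => g ζ + h ζ) x t = extension α g x t + extension α h x t := by
  have key : ∀ {u : EuclideanSpace ℝ (Fin d) → ℂ}, Integrable u →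
      Integrable fun ζ => planeWave α x t ζ * u ζ := fun hu =>
    memLp_one_iff_integrable.1 (memLp_planeWave_mul hα x t (memLp_one_iff_integrable.2 hu))
  unfold extension
  simp only [mul_add]
  exact integral_add (key hg) (key hh)

lemma add_sq_le_two_mul (a b : ℝ≥0∞) : (a + b) ^ 2 ≤ 2 * (a ^ 2 + b ^ 2) := by
  have := ENNReal.rpow_add_le_mul_rpow_add_rpow a b (p := 2) (by norm_num)
  norm_num at this
  exact this

lemma maximalSq_add_le (hα : 0 < α) {g h : EuclideanSpace ℝ (Fin d) → ℂ} (hg : Integrable g)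
    (hh : Integrable h) (T : Set ℝ) (μ : Measure (EuclideanSpace ℝ (Fin d))) :
    maximalSq α T (fun ζ => g ζ + h ζ) μ ≤ 2 * (maximalSq α T g μ + maximalSq α T h μ) := by
  unfold maximalSq
  rw [← lintegral_add_left (measurable_iSup_extension hα hg T),
    ← lintegral_const_mul (f := fun x => (⨆ t ∈ T, ‖extension α g x t‖ₑ) ^ 2 +
      (⨆ t ∈ T, ‖extension α h x t‖ₑ) ^ 2) _ ((measurable_iSup_extension hα hg T).add
      (measurable_iSup_extension hα hh T))]
  refine lintegral_mono fun x => le_trans ?_ (add_sq_le_two_mul _ _)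
  gcongr
  refine iSup₂_le fun t ht => ?_
  rw [extension_add hα hg hh]
  refine (enorm_add_le _ _).trans (add_le_add ?_ ?_)
  · exact le_biSup (fun t => ‖extension α g x t‖ₑ) ht
  · exact le_biSup (fun t => ‖extension α h x t‖ₑ) ht

/-- The propagator is a rescaled extension operator applied to the Fourier transform. -/
lemma schrodinger_eq (f : L2Space d) (x : EuclideanSpace ℝ (Fin d)) (t : ℝ) {N : ℝ} (hN : 0 < N) :
    schrodinger α t f x = ((N ^ d : ℝ) : ℂ) *
      extension α (fun η => (𝓕 f : L2Space d) (N • η)) (N • x) ((2 * Real.pi * N) ^ α * t) := by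
  have hc : 0 < 2 * Real.pi * N := by positivity
  have h := Measure.integral_comp_smul (volume : Measure (EuclideanSpace ℝ (Fin d)))
    (fun ξ => Complex.exp (Complex.I * ((inner ℝ x ξ + t * ‖ξ‖ ^ α : ℝ) : ℂ)) * fourierHat f ξ)
    (2 * Real.pi * N)
  have h2 : extension α (fun η => (𝓕 f : L2Space d) (N • η)) (N • x) ((2 * Real.pi * N) ^ α * t) =
      ∫ η : EuclideanSpace ℝ (Fin d), Complex.exp (Complex.I *
        ((inner ℝ x ((2 * Real.pi * N) • η) + t * ‖(2 * Real.pi * N) • η‖ ^ α : ℝ) : ℂ)) *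
          fourierHat f ((2 * Real.pi * N) • η) := by
    unfold extension
    refine integral_congr_ae (Filter.Eventually.of_forall fun η => ?_)
    simp only [planeWave, fourierHat, smul_smul, inner_smul_left, inner_smul_right, norm_smul,
      Real.norm_of_nonneg hc.le, Real.mul_rpow hc.le (norm_nonneg _)]
    congr 4
    · simp only [conj_trivial]; ring
    · field_simp
  rw [h2, h, schrodinger, finrank_euclideanSpace_fin, Complex.real_smul, ← mul_assoc,
    ← Complex.ofReal_mul]
  congr 2
  rw [abs_of_pos (by positivity)]
  field_simp
  ring

end Basic

/-! ### Rescaling between frequency `R` on the unit ball and fixed frequency on large balls. -/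

section Transfer

variable {d : ℕ} {α γ : ℝ}

lemma sq_maximalNorm {ι : Type} (t : ι → ℝ) (f : L2Space d)
    (μ : Measure (EuclideanSpace ℝ (Fin d))) :
    maximalNorm α t f μ ^ 2 = ∫⁻ x in ball 0 1, (⨆ i, ‖schrodinger α (t i) f x‖ₑ) ^ 2 ∂μ := by
  rw [maximalNorm, eLpNorm_eq_lintegral_rpow_enorm_toReal (by norm_num) (by norm_num),
    ← ENNReal.rpow_natCast, ← ENNReal.rpow_mul]
  norm_num

lemma ofReal_norm_sq (f : L2Space d) : ENNReal.ofReal (‖f‖ ^ 2) = sqNorm f := by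
  rw [Lp.norm_def, ENNReal.ofReal_pow ENNReal.toReal_nonneg,
    ENNReal.ofReal_toReal (Lp.eLpNorm_ne_top f),
    eLpNorm_eq_lintegral_rpow_enorm_toReal (by norm_num) (by norm_num), ← ENNReal.rpow_natCast,
    ← ENNReal.rpow_mul]
  simp [sqNorm]

lemma sqNorm_congr {g h : EuclideanSpace ℝ (Fin d) → ℂ} (hgh : g =ᵐ[volume] h) :
    sqNorm g = sqNorm h :=
  lintegral_congr_ae (hgh.mono fun ζ hζ => by simp [hζ])

lemma extension_congr {g h : EuclideanSpace ℝ (Fin d) → ℂ} (hgh : g =ᵐ[volume] h) :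
    extension α g = extension α h := by
  funext x t
  exact integral_congr_ae (hgh.mono fun ζ hζ => by simp [hζ])

lemma sqNorm_comp_smul (g : EuclideanSpace ℝ (Fin d) → ℂ)
    {N : ℝ} (hN : 0 < N) :
    ENNReal.ofReal (N ^ d) * sqNorm (fun η => g (N • η)) = sqNorm g := by
  have h := Measure.map_addHaar_smul (volume : Measure (EuclideanSpace ℝ (Fin d))) hN.ne'
  have h1 : ∫⁻ ζ, ‖g ζ‖ₑ ^ 2 ∂(Measure.map (N • ·) volume) = sqNorm (fun η => g (N • η)) :=
    (MeasurableEquiv.smul₀ N hN.ne').measurableEmbedding.lintegral_map _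
  rw [← h1, h, lintegral_smul_measure, finrank_euclideanSpace_fin, smul_eq_mul, ← mul_assoc,
    ← ENNReal.ofReal_mul (by positivity), abs_of_pos (by positivity),
    mul_inv_cancel₀ (by positivity), ENNReal.ofReal_one, one_mul, sqNorm]

lemma sqNorm_lt_top {g : EuclideanSpace ℝ (Fin d) → ℂ} (hg : MemLp g 2 volume) : sqNorm g < ⊤ := by
  have := hg.2
  rw [eLpNorm_lt_top_iff_lintegral_rpow_enorm_lt_top (by norm_num) (by norm_num)] at this
  simpa [sqNorm] using this

lemma memLp_comp_smul {g : EuclideanSpace ℝ (Fin d) → ℂ} (hg : MemLp g 2 volume)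
    {N : ℝ} (hN : N ≠ 0) : MemLp (fun η => g (N • η)) 2 volume := by
  refine MemLp.comp_of_map (f := fun η => N • η) (g := g) ?_
    (Measurable.aemeasurable (measurable_const_smul N))
  rw [Measure.map_addHaar_smul _ hN]
  exact hg.smul_measure ENNReal.ofReal_ne_top

/-- The affine map carrying `ball y N` to the unit ball. -/
noncomputable def toUnitBall (y : EuclideanSpace ℝ (Fin d)) (N : ℝ)
    (z : EuclideanSpace ℝ (Fin d)) : EuclideanSpace ℝ (Fin d) :=
  N⁻¹ • (z - y)

lemma measurable_toUnitBall (y : EuclideanSpace ℝ (Fin d)) (N : ℝ) :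
    Measurable (toUnitBall y N) := by
  unfold toUnitBall
  fun_prop

lemma toUnitBall_preimage_ball (y x : EuclideanSpace ℝ (Fin d)) {N : ℝ} (hN : 0 < N) (ρ : ℝ) :
    toUnitBall y N ⁻¹' ball x ρ = ball (y + N • x) (N * ρ) := by
  ext z
  have : z - (y + N • x) = N • (toUnitBall y N z - x) := by
    rw [toUnitBall, smul_sub, smul_inv_smul₀ hN.ne']; abel
  rw [Set.mem_preimage, mem_ball, mem_ball, dist_eq_norm, dist_eq_norm, this, norm_smul,
    Real.norm_of_nonneg hN.le, mul_lt_mul_iff_right₀ hN]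

lemma ballConstants_map_toUnitBall {μ : Measure (EuclideanSpace ℝ (Fin d))} {D : ℝ}
    (hD : D ∈ ballConstants γ μ) (y : EuclideanSpace ℝ (Fin d)) {N : ℝ} (hN : 0 < N) :
    D * N ^ γ ∈ ballConstants γ (μ.map (toUnitBall y N)) := by
  refine ⟨mul_nonneg hD.1 (by positivity), fun x ρ hρ => ?_⟩
  rw [Measure.map_apply (measurable_toUnitBall y N) measurableSet_ball,
    toUnitBall_preimage_ball y x hN]
  refine (hD.2 _ _ (by positivity)).trans_eq ?_
  rw [Real.mul_rpow hN.le hρ.le, mul_assoc]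

lemma dimConst_le {μ : Measure (EuclideanSpace ℝ (Fin d))} {D : ℝ}
    (hD : D ∈ ballConstants γ μ) : dimConst γ μ ≤ D :=
  csInf_le ⟨0, fun _ h => h.1⟩ hD

lemma dimConst_nonneg (μ : Measure (EuclideanSpace ℝ (Fin d))) : 0 ≤ dimConst γ μ :=
  Real.sInf_nonneg fun _ h => h.1

/-- The infimum is attained: for fixed ball the inequality is closed in the constant, so it survives
the limit from the right. -/
lemma dimConst_mem {μ : Measure (EuclideanSpace ℝ (Fin d))} (hμ : IsDimensional γ μ) :
    dimConst γ μ ∈ ballConstants γ μ := by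
  refine ⟨dimConst_nonneg μ, fun x ρ hρ => ?_⟩
  have h1 : Filter.Tendsto (fun D : ℝ => ENNReal.ofReal (D * ρ ^ γ))
      (nhdsWithin (dimConst γ μ) (Set.Ioi (dimConst γ μ)))
      (nhds (ENNReal.ofReal (dimConst γ μ * ρ ^ γ))) :=
    (ENNReal.continuous_ofReal.comp (continuous_id.mul continuous_const)).continuousAt.tendsto
      |>.mono_left nhdsWithin_le_nhds
  refine ge_of_tendsto h1 ?_
  filter_upwards [self_mem_nhdsWithin] with D hD
  obtain ⟨D', hD', hlt⟩ := exists_lt_of_csInf_lt hμ hD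
  refine (hD'.2 x ρ hρ).trans (ENNReal.ofReal_le_ofReal ?_)
  gcongr

lemma lintegral_iSup_schrodinger {ι : Type} (τ : ι → ℝ) (f : L2Space d)
    (g : EuclideanSpace ℝ (Fin d) → ℂ) (hα : 0 < α) (y : EuclideanSpace ℝ (Fin d)) {N : ℝ}
    (hN : 0 < N) (hg : Integrable g)
    (hfg : (fun η => (𝓕 f : L2Space d) (N • η)) =ᵐ[volume] fun η => planeWave α y 0 η * g η)
    (μ : Measure (EuclideanSpace ℝ (Fin d))) :
    ∫⁻ x in ball 0 1, (⨆ i, ‖schrodinger α (τ i) f x‖ₑ) ^ 2 ∂(μ.map (toUnitBall y N)) =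
      ENNReal.ofReal (N ^ d) ^ 2 *
        maximalSq α (Set.range fun i => (2 * Real.pi * N) ^ α * τ i) g (μ.restrict (ball y N)) := by
  have h1 : ∀ x i, ‖schrodinger α (τ i) f x‖ₑ =
      ENNReal.ofReal (N ^ d) * ‖extension α g (N • x + y) ((2 * Real.pi * N) ^ α * τ i)‖ₑ := by
    intro x i
    rw [schrodinger_eq f x (τ i) hN, extension_congr hfg, extension_planeWave_mul, add_zero,
      enorm_mul, ← ofReal_norm ((N ^ d : ℝ) : ℂ), Complex.norm_real,
      Real.norm_of_nonneg (by positivity)]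
  have h2 : ∀ x, (⨆ i, ‖schrodinger α (τ i) f x‖ₑ) ^ 2 = ENNReal.ofReal (N ^ d) ^ 2 *
      (⨆ t ∈ Set.range fun i => (2 * Real.pi * N) ^ α * τ i,
        ‖extension α g (N • x + y) t‖ₑ) ^ 2 := by
    intro x
    simp only [h1, iSup_range, ← ENNReal.mul_iSup, mul_pow]
  have hm : Measurable fun x => (⨆ t ∈ Set.range fun i => (2 * Real.pi * N) ^ α * τ i,
        ‖extension α g (N • x + y) t‖ₑ) ^ 2 :=
    (measurable_iSup_extension hα hg _).comp (by fun_prop : Measurable fun x => N • x + y)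
  have h3 : ∀ z, N • toUnitBall y N z + y = z := fun z => by
    rw [toUnitBall, smul_inv_smul₀ hN.ne', sub_add_cancel]
  simp only [h2]
  rw [lintegral_const_mul _ hm, setLIntegral_map measurableSet_ball hm (measurable_toUnitBall y N),
    toUnitBall_preimage_ball y 0 hN, smul_zero, add_zero, mul_one, maximalSq]
  simp only [h3]

/-- The maximal estimate for the extension operator at frequencies of size `l`, on all balls of
radius `N ≥ 1` and over the times `(0, N ^ α]`. -/
def LocalMaximalBound (d : ℕ) (α γ s l : ℝ) (C : ℝ≥0) : Prop :=
  ∀ N : ℝ, 1 ≤ N → ∀ (y : EuclideanSpace ℝ (Fin d))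
    (μ : Measure (EuclideanSpace ℝ (Fin d))), ∀ D ∈ ballConstants γ μ,
    ∀ g : EuclideanSpace ℝ (Fin d) → ℂ, MemLp g 2 volume → (∀ ζ, ζ ∉ annulus d l → g ζ = 0) →
      maximalSq α (Set.Ioc 0 (N ^ α)) g (μ.restrict (ball y N)) ≤
        C * (ENNReal.ofReal (N ^ (2 * s) * D) * sqNorm g)

lemma smul_mem_annulus_iff {N : ℝ} (hN : 0 < N) (l : ℝ) (ζ : EuclideanSpace ℝ (Fin d)) :
    N • ζ ∈ annulus d (N * l) ↔ ζ ∈ annulus d l := by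
  simp only [annulus, Set.mem_ofPred_eq, norm_smul, Real.norm_of_nonneg hN.le,
    mul_left_comm 2 N l, mul_le_mul_iff_right₀ hN]

/-- The power `N ^ γ` from rescaling the measure cancels the `-γ` in the exponent. The factor `(N ^
d) ^ 2` is the one produced by rescaling the propagator, so only `N ^ (2 * s)` remains. -/
lemma sq_scaled_bound (d : ℕ) {s γ N D l u : ℝ} (C : ℝ) (hl : 0 ≤ l) (hN : 0 < N) (hD : 0 ≤ D)
    (q : ℝ) (hu : u ^ 2 = N ^ d * q) :
    (C * (l * N) ^ (((d : ℝ) - γ) / 2 + s) * (D * N ^ γ) ^ ((1 : ℝ) / 2) * u) ^ 2 =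
      (N ^ d) ^ 2 * (C ^ 2 * l ^ ((d : ℝ) - γ + 2 * s) * N ^ (2 * s) * D * q) := by
  have hD' : 0 ≤ D * N ^ γ := mul_nonneg hD (by positivity)
  have e1 : ((l * N) ^ (((d : ℝ) - γ) / 2 + s)) ^ 2 =
      l ^ ((d : ℝ) - γ + 2 * s) * N ^ ((d : ℝ) - γ + 2 * s) := by
    rw [← Real.rpow_natCast (_ ^ _), ← Real.rpow_mul (by positivity), ← Real.mul_rpow hl hN.le]
    congr 1
    push_cast
    ring
  have e2 : ((D * N ^ γ) ^ ((1 : ℝ) / 2)) ^ 2 = D * N ^ γ := by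
    rw [← Real.sqrt_eq_rpow, Real.sq_sqrt hD']
  have e3 : N ^ ((d : ℝ) - γ + 2 * s) * N ^ γ = N ^ d * N ^ (2 * s) := by
    rw [← Real.rpow_natCast N d, ← Real.rpow_add hN, ← Real.rpow_add hN]
    congr 1
    ring
  rw [mul_pow, mul_pow, mul_pow, hu, e1, e2]
  linear_combination C ^ 2 * l ^ ((d : ℝ) - γ + 2 * s) * D * N ^ d * q * e3

/-- The hypothesis is used at `R = 2 * π * l * N` for the image of `μ` under the affine map of `ball
y N` onto the unit ball. The centre `y` is absorbed by a modulation of `g`. -/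
lemma exists_localMaximalBound {s : ℝ} (hα : 0 < α) (hmax : ∃ C : ℝ, 0 < C ∧ ∀ R : ℝ, 1 ≤ R →
      ∀ μ : Measure (EuclideanSpace ℝ (Fin d)), IsDimensional γ μ →
      ∀ f : L2Space d, FourierSupportedIn f R →
        maximalNorm α (fun t : Set.Ioc (0 : ℝ) 1 => (t : ℝ)) f μ ≤
          ENNReal.ofReal
            (C * R ^ (((d : ℝ) - γ) / 2 + s) * dimConst γ μ ^ ((1 : ℝ) / 2) * ‖f‖))
    {l : ℝ} (hl : 1 ≤ 2 * Real.pi * l) : ∃ C, LocalMaximalBound d α γ s l C := by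
  obtain ⟨C, hC, hmax⟩ := hmax
  have hl0 : 0 < l := by
    by_contra h
    have := mul_nonpos_of_nonneg_of_nonpos (by positivity : 0 ≤ 2 * Real.pi) (not_lt.1 h)
    linarith
  refine ⟨(C ^ 2 * (2 * Real.pi * l) ^ ((d : ℝ) - γ + 2 * s)).toNNReal, ?_⟩
  intro N hN y μ D hD g hg hgl
  have hN0 : 0 < N := by linarith
  have hgi := integrable_of_vanish_off_annulus hg hgl
  set G : EuclideanSpace ℝ (Fin d) → ℂ := fun ζ => planeWave α y 0 (N⁻¹ • ζ) * g (N⁻¹ • ζ) with hG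
  have hGm : MemLp G 2 volume :=
    memLp_comp_smul (memLp_planeWave_mul hα y 0 hg) (inv_ne_zero hN0.ne')
  obtain ⟨f, hf⟩ : ∃ f : L2Space d, f = 𝓕⁻ hGm.toLp := ⟨_, rfl⟩
  have hfG : (𝓕 f : L2Space d) =ᵐ[volume] G := by
    rw [hf, FourierTransform.fourier_fourierInv_eq]
    exact hGm.coeFn_toLp
  have hfg : (fun η => (𝓕 f : L2Space d) (N • η)) =ᵐ[volume]
      fun η => planeWave α y 0 η * g η := by
    filter_upwards [(Measure.quasiMeasurePreserving_smul volume hN0.ne').ae hfG] with η hη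
    rw [hη, hG]
    simp only [inv_smul_smul₀ hN0.ne']
  set R := 2 * Real.pi * l * N with hR
  have hR1 : 1 ≤ R := by nlinarith
  have hsupp : FourierSupportedIn f R := by
    have hne : (2 * Real.pi)⁻¹ ≠ 0 := by positivity
    filter_upwards [(Measure.quasiMeasurePreserving_smul volume hne).ae hfG] with ξ hξ hξR
    rw [fourierHat, hξ, hG]
    simp only
    rw [hgl, mul_zero]
    rw [← smul_mem_annulus_iff hN0, smul_inv_smul₀ hN0.ne',
      ← smul_mem_annulus_iff (by positivity : 0 < 2 * Real.pi), smul_inv_smul₀ (by positivity)]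
    rwa [show 2 * Real.pi * (N * l) = R by rw [hR]; ring]
  have hD' := ballConstants_map_toUnitBall hD y hN0
  have key := hmax R hR1 (μ.map (toUnitBall y N)) ⟨_, hD'⟩ f hsupp
  have hnorm : ‖f‖ ^ 2 = N ^ d * (sqNorm g).toReal := by
    have h1 : ‖f‖ = ‖(𝓕 f : L2Space d)‖ := (Lp.norm_fourier_eq f).symm
    have h2 : ENNReal.ofReal (‖f‖ ^ 2) = ENNReal.ofReal (N ^ d) * sqNorm g := by
      have h3 := sqNorm_comp_smul (fun ζ => (𝓕 f : L2Space d) ζ) hN0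
      have h4 : ENNReal.ofReal (‖(𝓕 f : L2Space d)‖ ^ 2) =
          sqNorm (fun ζ => (𝓕 f : L2Space d) ζ) := ofReal_norm_sq _
      rw [h1, h4, ← h3, sqNorm_congr hfg, sqNorm_planeWave_mul]
    rw [← ENNReal.toReal_ofReal (by positivity : 0 ≤ ‖f‖ ^ 2), h2, ENNReal.toReal_mul,
      ENNReal.toReal_ofReal (by positivity)]
  have hle : maximalNorm α (fun t : Set.Ioc (0 : ℝ) 1 => (t : ℝ)) f (μ.map (toUnitBall y N)) ≤
      ENNReal.ofReal (C * R ^ (((d : ℝ) - γ) / 2 + s) * (D * N ^ γ) ^ ((1 : ℝ) / 2) * ‖f‖) := by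
    refine key.trans (ENNReal.ofReal_le_ofReal ?_)
    gcongr
    · exact dimConst_nonneg _
    · exact dimConst_le hD'
  have hsq := pow_le_pow_left' hle 2
  rw [sq_maximalNorm, lintegral_iSup_schrodinger _ f g hα y hN0 hgi hfg,
    ← ENNReal.ofReal_pow (mul_nonneg (mul_nonneg (by positivity)
      (Real.rpow_nonneg hD'.1 _)) (norm_nonneg _)), ← ENNReal.ofReal_pow (by positivity)] at hsq
  have hcalc := sq_scaled_bound d (s := s) (γ := γ) C (by positivity : 0 ≤ 2 * Real.pi * l) hN0 hD.1
    (sqNorm g).toReal hnorm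
  rw [hcalc, ENNReal.ofReal_mul (by positivity)] at hsq
  have hN2 : ENNReal.ofReal ((N ^ d) ^ 2) ≠ 0 := by
    rw [ne_eq, ENNReal.ofReal_eq_zero, not_le]; positivity
  rw [ENNReal.mul_le_mul_iff_right hN2 ENNReal.ofReal_ne_top, ENNReal.ofReal_mul (mul_nonneg
    (by positivity) hD.1), ENNReal.ofReal_toReal (sqNorm_lt_top hg).ne,
    mul_assoc (C ^ 2 * (2 * Real.pi * l) ^ ((d : ℝ) - γ + 2 * s)),
    ENNReal.ofReal_mul (by positivity), mul_assoc (ENNReal.ofReal _)] at hsq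
  -- The times `(0, 1]` rescale to `(0, (2 * π * N) ^ α]`, which contains `(0, N ^ α]`.
  refine le_trans (maximalSq_mono ?_ le_rfl) hsq
  intro t ht
  have hc : 0 < (2 * Real.pi * N) ^ α := by positivity
  refine ⟨⟨((2 * Real.pi * N) ^ α)⁻¹ * t, mul_pos (inv_pos.2 hc) ht.1, ?_⟩, ?_⟩
  · rw [inv_mul_le_iff₀ hc, mul_one]
    refine ht.2.trans (Real.rpow_le_rpow hN0.le ?_ hα.le)
    nlinarith [Real.pi_gt_three]
  · simp only
    field_simp

end Transfer

/-! ### Polynomial weights as differential operators on the Fourier side. -/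

section Pairing

open SchwartzMap LineDeriv
open scoped SchwartzMap

variable {d : ℕ}

/-- The multiplication formula, read off from the compatibility of the `L²` and distributional
Fourier transforms. It lets a weight be moved between the two sides. -/
lemma integral_schwartz_mul_fourier (h : 𝓢(EuclideanSpace ℝ (Fin d), ℂ)) (u : L2Space d) :
    ∫ ζ, h ζ * (𝓕 u : L2Space d) ζ = ∫ y, (𝓕 h) y * u y := by
  have key := congrArg (fun T => T h) (Lp.fourier_toTemperedDistribution_eq u)
  simp only [TemperedDistribution.fourier_apply, Lp.toTemperedDistribution_apply,
    smul_eq_mul] at key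
  exact key.symm

/-- The operator corresponding on the Fourier side to multiplication by `(y_j - a_j) / N`. -/
noncomputable def shiftedDeriv (N : ℝ) (a : EuclideanSpace ℝ (Fin d)) (j : Fin d)
    (h : 𝓢(EuclideanSpace ℝ (Fin d), ℂ)) : 𝓢(EuclideanSpace ℝ (Fin d), ℂ) :=
  (2 * Real.pi * N : ℂ)⁻¹ • ((-Complex.I) • ∂_{EuclideanSpace.single j (1 : ℝ)} h -
    (2 * Real.pi * a j : ℂ) • h)

/-- The operator corresponding on the Fourier side to multiplication by
`1 + |(y - a) / N|²`. -/
noncomputable def weightOperator (N : ℝ) (a : EuclideanSpace ℝ (Fin d))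
    (h : 𝓢(EuclideanSpace ℝ (Fin d), ℂ)) : 𝓢(EuclideanSpace ℝ (Fin d), ℂ) :=
  h + ∑ j, shiftedDeriv N a j (shiftedDeriv N a j h)

lemma fourier_shiftedDeriv {N : ℝ} (hN : N ≠ 0) (a : EuclideanSpace ℝ (Fin d)) (j : Fin d)
    (h : 𝓢(EuclideanSpace ℝ (Fin d), ℂ)) (y : EuclideanSpace ℝ (Fin d)) :
    (𝓕 (shiftedDeriv N a j h)) y = (((y j - a j) / N : ℝ) : ℂ) * (𝓕 h) y := by
  have hpi : (Real.pi : ℂ) ≠ 0 := by exact_mod_cast Real.pi_ne_zero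
  have hN' : (N : ℂ) ≠ 0 := by exact_mod_cast hN
  have hlin : 𝓕 (shiftedDeriv N a j h) = (2 * Real.pi * N : ℂ)⁻¹ •
      ((-Complex.I) • 𝓕 (∂_{EuclideanSpace.single j (1 : ℝ)} h) -
        (2 * Real.pi * a j : ℂ) • 𝓕 h) := by
    simp only [shiftedDeriv, ← FourierTransform.fourierCLM_apply (R := ℂ), map_smul, map_sub]
  have htg : Function.HasTemperateGrowth
      (fun x : EuclideanSpace ℝ (Fin d) => inner ℝ x (EuclideanSpace.single j (1 : ℝ))) := by
    fun_prop
  rw [hlin, SchwartzMap.fourier_lineDerivOp_eq]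
  simp only [smul_apply, sub_apply, smul_eq_mul]
  rw [SchwartzMap.smulLeftCLM_apply_apply htg, Complex.real_smul, EuclideanSpace.inner_single_right]
  simp only [conj_trivial, one_mul]
  push_cast
  field_simp
  ring_nf
  simp only [Complex.I_sq]
  ring

lemma fourier_weightOperator {N : ℝ} (hN : N ≠ 0) (a : EuclideanSpace ℝ (Fin d))
    (h : 𝓢(EuclideanSpace ℝ (Fin d), ℂ)) (y : EuclideanSpace ℝ (Fin d)) :
    (𝓕 (weightOperator N a h)) y = ((1 + ‖N⁻¹ • (y - a)‖ ^ 2 : ℝ) : ℂ) * (𝓕 h) y := by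
  have hlin : 𝓕 (weightOperator N a h) =
      𝓕 h + ∑ j, 𝓕 (shiftedDeriv N a j (shiftedDeriv N a j h)) := by
    simp only [weightOperator, ← FourierTransform.fourierCLM_apply (R := ℂ), map_add, map_sum]
  rw [hlin]
  simp only [add_apply, sum_apply, fourier_shiftedDeriv hN, EuclideanSpace.norm_sq_eq]
  push_cast
  rw [add_mul, one_mul, Finset.sum_mul]
  congr 1
  refine Finset.sum_congr rfl fun j _ => ?_
  rw [← mul_assoc, ← Complex.ofReal_pow, Real.norm_eq_abs, sq_abs]
  simp only [PiLp.smul_apply, PiLp.sub_apply, smul_eq_mul]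
  push_cast
  ring

lemma fourier_iterate_weightOperator {N : ℝ} (hN : N ≠ 0) (a : EuclideanSpace ℝ (Fin d))
    (m : ℕ) (h : 𝓢(EuclideanSpace ℝ (Fin d), ℂ)) (y : EuclideanSpace ℝ (Fin d)) :
    (𝓕 ((weightOperator N a)^[m] h)) y =
      (((1 + ‖N⁻¹ • (y - a)‖ ^ 2) ^ m : ℝ) : ℂ) * (𝓕 h) y := by
  induction m with
  | zero => simp
  | succ m ih =>
    rw [Function.iterate_succ_apply', fourier_weightOperator hN, ih]
    push_cast
    ring

end Pairing

/-! ### Stability of localized plane waves under the weight operators. -/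

section WaveSum

open SchwartzMap LineDeriv
open scoped SchwartzMap ContDiff

/-- Parameters of a localized wave: a ball `ball center radius`, a position and a time. -/
structure WaveParam (d : ℕ) where
  radius : ℝ
  center : EuclideanSpace ℝ (Fin d)
  pos : EuclideanSpace ℝ (Fin d)
  time : ℝ

/-- The position lies in the ball and the time does not exceed the radius. -/
def WaveParam.Admissible {d : ℕ} (p : WaveParam d) : Prop :=
  1 ≤ p.radius ∧ ‖p.pos - p.center‖ ≤ p.radius ∧ |p.time| ≤ p.radius

/-- A smooth amplitude supported in `1/2 ≤ |ζ| ≤ 4`. -/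
structure IsAmplitude {d : ℕ} (B : EuclideanSpace ℝ (Fin d) → ℂ) : Prop where
  contDiff : ContDiff ℝ ∞ B
  tsupport_subset : tsupport B ⊆ {ζ | 1 / 2 ≤ ‖ζ‖ ∧ ‖ζ‖ ≤ 4}

/-- Families of Schwartz functions that are finite sums of plane waves with a fixed amplitude and a
coefficient bounded over the admissible parameters. -/
inductive IsWaveSum {d : ℕ} (α : ℝ) :
    (WaveParam d → 𝓢(EuclideanSpace ℝ (Fin d), ℂ)) → Prop
  | term (c : WaveParam d → ℂ) (B : EuclideanSpace ℝ (Fin d) → ℂ)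
      (h : WaveParam d → 𝓢(EuclideanSpace ℝ (Fin d), ℂ))
      (hc : ∃ K : ℝ, ∀ p : WaveParam d, p.Admissible → ‖c p‖ ≤ K) (hB : IsAmplitude B)
      (hh : ∀ p ζ, h p ζ = c p * (planeWave α p.pos p.time ζ * B ζ)) : IsWaveSum α h
  | add (h₁ h₂ : WaveParam d → 𝓢(EuclideanSpace ℝ (Fin d), ℂ)) :
      IsWaveSum α h₁ → IsWaveSum α h₂ → IsWaveSum α (fun p => h₁ p + h₂ p)

variable {d : ℕ} {α : ℝ}

lemma isCompact_amplitude_support :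
    IsCompact {ζ : EuclideanSpace ℝ (Fin d) | 1 / 2 ≤ ‖ζ‖ ∧ ‖ζ‖ ≤ 4} := by
  refine (isCompact_closedBall (0 : EuclideanSpace ℝ (Fin d)) 4).of_isClosed_subset ?_ ?_
  · exact (isClosed_le continuous_const continuous_norm).inter
      (isClosed_le continuous_norm continuous_const)
  · intro ζ hζ
    simpa using hζ.2

namespace IsAmplitude

variable {B : EuclideanSpace ℝ (Fin d) → ℂ}

lemma hasCompactSupport (hB : IsAmplitude B) : HasCompactSupport B :=
  isCompact_amplitude_support.of_isClosed_subset (isClosed_tsupport B) hB.tsupport_subset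

lemma ne_zero (hB : IsAmplitude B) {ζ : EuclideanSpace ℝ (Fin d)} (hζ : ζ ∈ tsupport B) :
    ζ ≠ 0 := by
  rintro rfl
  have := (hB.tsupport_subset hζ).1
  norm_num at this

lemma eq_zero (hB : IsAmplitude B) {ζ : EuclideanSpace ℝ (Fin d)}
    (hζ : ¬(1 / 2 ≤ ‖ζ‖ ∧ ‖ζ‖ ≤ 4)) : B ζ = 0 := by
  by_contra h
  exact hζ (hB.tsupport_subset (subset_tsupport B h))

lemma exists_bound (hB : IsAmplitude B) : ∃ K : ℝ, 0 ≤ K ∧ ∀ ζ, ‖B ζ‖ ≤ K := by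
  obtain ⟨K, hK⟩ := hB.contDiff.continuous.bounded_above_of_compact_support hB.hasCompactSupport
  exact ⟨K, (norm_nonneg _).trans (hK 0), hK⟩

/-- Multiplication by a function smooth off the origin. -/
lemma mul (hB : IsAmplitude B) {u : EuclideanSpace ℝ (Fin d) → ℂ}
    (hu : ∀ ζ, ζ ≠ 0 → ContDiffAt ℝ ∞ u ζ) : IsAmplitude (fun ζ => u ζ * B ζ) := by
  have hs : tsupport (fun ζ => u ζ * B ζ) ⊆ tsupport B := tsupport_mul_subset_right
  refine ⟨contMDiff_iff_contDiff.1 (contMDiff_of_tsupport fun ζ hζ =>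
    contMDiffAt_iff_contDiffAt.2 ?_), hs.trans hB.tsupport_subset⟩
  exact (hu ζ (hB.ne_zero (hs hζ))).mul hB.contDiff.contDiffAt

lemma lineDeriv (hB : IsAmplitude B) (v : EuclideanSpace ℝ (Fin d)) :
    IsAmplitude (fun ζ => fderiv ℝ B ζ v) := by
  refine ⟨(hB.contDiff.fderiv_right (by norm_num)).clm_apply contDiff_const, ?_⟩
  refine (closure_minimal ?_ (isClosed_tsupport B)).trans hB.tsupport_subset
  intro ζ hζ
  refine support_fderiv_subset ℝ (f := B) fun h => hζ ?_
  simp only [h]; rfl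

end IsAmplitude

lemma contDiffAt_norm_rpow {ζ : EuclideanSpace ℝ (Fin d)} (hζ : ζ ≠ 0) (a : ℝ) :
    ContDiffAt ℝ ∞ (fun η : EuclideanSpace ℝ (Fin d) => ‖η‖ ^ a) ζ :=
  (contDiffAt_norm ℝ hζ).rpow_const_of_ne (norm_ne_zero_iff.2 hζ)

lemma hasFDerivAt_norm_rpow_of_ne_zero {ζ : EuclideanSpace ℝ (Fin d)} (hζ : ζ ≠ 0) (a : ℝ) :
    HasFDerivAt (fun η : EuclideanSpace ℝ (Fin d) => ‖η‖ ^ a)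
      ((a * ‖ζ‖ ^ (a - 2)) • innerSL ℝ ζ) ζ := by
  apply HasStrictFDerivAt.hasFDerivAt
  convert! (hasStrictFDerivAt_norm_sq ζ).rpow_const (p := a / 2) (by simp [hζ]) using 0
  simp_rw [← Real.rpow_natCast_mul (norm_nonneg _), ← Nat.cast_smul_eq_nsmul ℝ, smul_smul]
  ring_nf

lemma contDiffAt_planeWave {ζ : EuclideanSpace ℝ (Fin d)} (hζ : ζ ≠ 0)
    (x : EuclideanSpace ℝ (Fin d)) (t : ℝ) : ContDiffAt ℝ ∞ (planeWave α x t) ζ := by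
  have h1 := contDiffAt_norm_rpow hζ α
  have h2 : ContDiffAt ℝ ∞ (fun η : EuclideanSpace ℝ (Fin d) =>
      2 * Real.pi * inner ℝ x η + t * ‖η‖ ^ α) ζ :=
    (contDiffAt_const.mul (contDiffAt_const.inner ℝ contDiffAt_id)).add (contDiffAt_const.mul h1)
  exact (contDiffAt_const.mul (Complex.ofRealCLM.contDiff.contDiffAt.comp ζ h2)).cexp

lemma fderiv_planeWave {ζ : EuclideanSpace ℝ (Fin d)} (hζ : ζ ≠ 0)
    (x : EuclideanSpace ℝ (Fin d)) (t : ℝ) (j : Fin d) :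
    fderiv ℝ (planeWave α x t) ζ (EuclideanSpace.single j 1) =
      planeWave α x t ζ * (Complex.I *
        ((2 * Real.pi * x j + t * (α * ‖ζ‖ ^ (α - 2) * ζ j) : ℝ) : ℂ)) := by
  have h1 : HasFDerivAt (fun η : EuclideanSpace ℝ (Fin d) =>
      2 * Real.pi * inner ℝ x η + t * ‖η‖ ^ α) _ ζ :=
    (((innerSL ℝ x).hasFDerivAt).const_mul (2 * Real.pi)).add
      ((hasFDerivAt_norm_rpow_of_ne_zero hζ α).const_mul t)
  have h2 : HasFDerivAt (planeWave α x t) _ ζ :=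
    ((Complex.ofRealCLM.hasFDerivAt.comp ζ h1).const_mul Complex.I).cexp
  rw [h2.fderiv]
  simp [planeWave, EuclideanSpace.inner_single_right, innerSL_apply_apply]
  ring

/-- An amplitude times a plane wave, as a Schwartz function. -/
noncomputable def amplitudeWave {B : EuclideanSpace ℝ (Fin d) → ℂ} (α : ℝ) (hB : IsAmplitude B)
    (p : WaveParam d) : 𝓢(EuclideanSpace ℝ (Fin d), ℂ) :=
  have hA := hB.mul (u := planeWave α p.pos p.time) fun _ hζ => contDiffAt_planeWave hζ _ _
  hA.hasCompactSupport.toSchwartzMap hA.contDiff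

lemma amplitudeWave_apply {B : EuclideanSpace ℝ (Fin d) → ℂ} (hB : IsAmplitude B)
    (p : WaveParam d) (ζ : EuclideanSpace ℝ (Fin d)) :
    amplitudeWave α hB p ζ = planeWave α p.pos p.time ζ * B ζ := rfl

lemma fderiv_planeWave_mul {B : EuclideanSpace ℝ (Fin d) → ℂ} (hB : IsAmplitude B)
    (x : EuclideanSpace ℝ (Fin d)) (t : ℝ) (j : Fin d) (ζ : EuclideanSpace ℝ (Fin d)) :
    fderiv ℝ (fun η => planeWave α x t η * B η) ζ (EuclideanSpace.single j 1) =
      planeWave α x t ζ * (fderiv ℝ B ζ (EuclideanSpace.single j 1) + Complex.I *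
        ((2 * Real.pi * x j + t * (α * ‖ζ‖ ^ (α - 2) * ζ j) : ℝ) : ℂ) * B ζ) := by
  by_cases hζ : ζ ∈ tsupport B
  · have h0 := hB.ne_zero hζ
    have h1 := (contDiffAt_planeWave (α := α) h0 x t).differentiableAt (by norm_num)
    have h2 : DifferentiableAt ℝ B ζ := hB.contDiff.differentiable (by norm_num) ζ
    rw [fderiv_fun_mul h1 h2]
    simp only [add_apply, smul_apply, smul_eq_mul, fderiv_planeWave h0]
    ring
  -- Off the support both sides vanish, so the possible singularity of `‖ζ‖ ^ α` at the origin is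
  -- harmless.
  · have h1 : B =ᶠ[nhds ζ] 0 := notMem_tsupport_iff_eventuallyEq.1 hζ
    have h2 : (fun η => planeWave α x t η * B η) =ᶠ[nhds ζ] 0 := by
      filter_upwards [h1] with η hη
      simp [hη]
    rw [h2.fderiv_eq, h1.fderiv_eq, h1.eq_of_nhds]
    simp

lemma norm_inv_two_pi_mul_le {N : ℝ} (hN : 1 ≤ N) :
    ‖(2 * Real.pi * N : ℂ)⁻¹‖ ≤ (2 * Real.pi * N)⁻¹ := by
  have h : (2 * Real.pi * N : ℂ) = ((2 * Real.pi * N : ℝ) : ℂ) := by push_cast; ring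
  rw [h, norm_inv, Complex.norm_real, Real.norm_of_nonneg (by positivity)]

lemma isWaveSum_amplitudeWave {B : EuclideanSpace ℝ (Fin d) → ℂ} (hB : IsAmplitude B)
    (c : WaveParam d → ℂ) (hc : ∃ K : ℝ, ∀ p : WaveParam d, p.Admissible → ‖c p‖ ≤ K) :
    IsWaveSum α fun p => c p • amplitudeWave α hB p :=
  .term c B _ hc hB fun p ζ => by rw [smul_apply, smul_eq_mul, amplitudeWave_apply]

/-- Differentiating a wave and subtracting `2π` times the centre leaves three terms: a derivative of
the amplitude, the factor `2π (pos - center)_j`, and `time` times the gradient of `‖ζ‖ ^ α`.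
Admissibility makes each coefficient `O(radius)`, which the division by `2π * radius` compensates.
-/
lemma IsWaveSum.shiftedDeriv {h : WaveParam d → 𝓢(EuclideanSpace ℝ (Fin d), ℂ)}
    (hh : IsWaveSum α h) (j : Fin d) :
    IsWaveSum α fun p => shiftedDeriv p.radius p.center j (h p) := by
  induction hh with
  | add h₁ h₂ _ _ ih₁ ih₂ =>
    convert IsWaveSum.add _ _ ih₁ ih₂ using 2 with p
    simp only [_root_.shiftedDeriv, lineDerivOp_add, ← smul_add]
    congr 1
    simp only [smul_add]
    abel
  | term c B h hc hB hh =>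
    obtain ⟨K, hK⟩ := hc
    -- The `ζ`-dependent part of the time term goes into the amplitude, so the coefficients depend
    -- on the parameters alone.
    have hu : ∀ ζ : EuclideanSpace ℝ (Fin d), ζ ≠ 0 →
        ContDiffAt ℝ ∞ (fun η => ((α * ‖η‖ ^ (α - 2) * η j : ℝ) : ℂ)) ζ := fun ζ hζ =>
      Complex.ofRealCLM.contDiff.contDiffAt.comp ζ
        ((contDiffAt_const.mul (contDiffAt_norm_rpow hζ _)).mul
          (EuclideanSpace.proj (𝕜 := ℝ) j).contDiff.contDiffAt)
    have hB₁ := hB.lineDeriv (EuclideanSpace.single j 1)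
    have hB₂ := hB.mul hu
    have hbound : ∀ (a : WaveParam d → ℂ) (M : ℝ), (∀ p, p.Admissible → ‖a p‖ ≤ M * p.radius) →
        ∃ K : ℝ, ∀ p : WaveParam d, p.Admissible →
          ‖(2 * Real.pi * p.radius : ℂ)⁻¹ * a p * c p‖ ≤ K := by
      intro a M hM
      refine ⟨(2 * Real.pi)⁻¹ * M * K, fun p hp => ?_⟩
      have hN : 0 < p.radius := by linarith [hp.1]
      have h1 : ‖(2 * Real.pi * p.radius : ℂ)⁻¹‖ * ‖a p‖ ≤ (2 * Real.pi)⁻¹ * M := by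
        calc _ ≤ (2 * Real.pi * p.radius)⁻¹ * (M * p.radius) :=
              mul_le_mul (norm_inv_two_pi_mul_le hp.1) (hM p hp) (norm_nonneg _) (by positivity)
          _ = _ := by field_simp
      rw [norm_mul, norm_mul]
      exact mul_le_mul h1 (hK p hp) (norm_nonneg _) (le_trans (by positivity) h1)
    have h1 := isWaveSum_amplitudeWave (α := α) hB₁ _ (hbound (fun _ => -Complex.I) 1
      fun p hp => by simpa using hp.1)
    have h2 := isWaveSum_amplitudeWave (α := α) hB _ (hbound
      (fun p => ((2 * Real.pi * (p.pos j - p.center j) : ℝ) : ℂ)) (2 * Real.pi) fun p hp => by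
        rw [Complex.norm_real, norm_mul, Real.norm_of_nonneg (by positivity)]
        gcongr
        exact (PiLp.norm_apply_le (p.pos - p.center) j).trans hp.2.1)
    have h3 := isWaveSum_amplitudeWave (α := α) hB₂ _ (hbound (fun p => (p.time : ℂ)) 1
      fun p hp => by simpa using hp.2.2)
    convert IsWaveSum.add _ _ h1 (.add _ _ h2 h3) using 2 with p
    ext ζ
    have hd : (∂_{EuclideanSpace.single j (1 : ℝ)} (h p)) ζ = c p * (planeWave α p.pos p.time ζ *
        (fderiv ℝ B ζ (EuclideanSpace.single j 1) + Complex.I *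
        ((2 * Real.pi * p.pos j + p.time * (α * ‖ζ‖ ^ (α - 2) * ζ j) : ℝ) : ℂ) * B ζ)) := by
      have he : (h p : EuclideanSpace ℝ (Fin d) → ℂ) =
          fun ζ => c p * (planeWave α p.pos p.time ζ * B ζ) := funext (hh p)
      have hA := hB.mul (u := planeWave α p.pos p.time) fun _ hζ => contDiffAt_planeWave hζ _ _
      rw [lineDerivOp_apply_eq_fderiv, he,
        fderiv_const_mul (hA.contDiff.differentiable (by norm_num) ζ), smul_apply,
        fderiv_planeWave_mul hB, smul_eq_mul]
    simp only [_root_.shiftedDeriv, smul_apply, sub_apply, add_apply, smul_eq_mul, hd, hh,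
      amplitudeWave_apply]
    push_cast
    linear_combination ((2 * Real.pi * p.radius : ℂ)⁻¹ * (-1) * c p * planeWave α p.pos p.time ζ *
      (2 * Real.pi * p.pos j + p.time * (α * ((‖ζ‖ ^ (α - 2) : ℝ) : ℂ) * ζ j)) * B ζ) *
        Complex.I_sq

lemma IsWaveSum.weightOperator {h : WaveParam d → 𝓢(EuclideanSpace ℝ (Fin d), ℂ)}
    (hh : IsWaveSum α h) : IsWaveSum α fun p => weightOperator p.radius p.center (h p) := by
  have key : ∀ F : Finset (Fin d), IsWaveSum α fun p =>
      h p + ∑ j ∈ F, _root_.shiftedDeriv p.radius p.center j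
        (_root_.shiftedDeriv p.radius p.center j (h p)) := by
    intro F
    induction F using Finset.induction_on with
    | empty => simpa using hh
    | insert j F hj ih =>
      convert IsWaveSum.add _ _ ih ((hh.shiftedDeriv j).shiftedDeriv j) using 2 with p
      rw [Finset.sum_insert hj]
      abel
  exact key Finset.univ

lemma IsWaveSum.iterate_weightOperator {h : WaveParam d → 𝓢(EuclideanSpace ℝ (Fin d), ℂ)}
    (hh : IsWaveSum α h) (m : ℕ) :
    IsWaveSum α fun p => (_root_.weightOperator p.radius p.center)^[m] (h p) := by
  induction m with
  | zero => simpa using hh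
  | succ m ih =>
    simp only [Function.iterate_succ_apply']
    exact ih.weightOperator

/-- A smooth cutoff equal to `1` on `1 ≤ |ζ| ≤ 2`. -/
lemma exists_isAmplitude_eq_one (d : ℕ) : ∃ B : EuclideanSpace ℝ (Fin d) → ℂ, IsAmplitude B ∧
    ∀ ζ ∈ annulus d 1, B ζ = 1 := by
  have hK : IsClosed (annulus d 1) :=
    (isClosed_le continuous_const continuous_norm).inter
      (isClosed_le continuous_norm continuous_const)
  have hU : IsOpen {ζ : EuclideanSpace ℝ (Fin d) | 1 / 2 < ‖ζ‖ ∧ ‖ζ‖ < 4} :=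
    (isOpen_lt continuous_const continuous_norm).inter (isOpen_lt continuous_norm continuous_const)
  have hdisj : Disjoint {ζ : EuclideanSpace ℝ (Fin d) | 1 / 2 < ‖ζ‖ ∧ ‖ζ‖ < 4}ᶜ (annulus d 1) := by
    refine Set.disjoint_compl_left_iff_subset.2 fun ζ hζ => ⟨?_, ?_⟩
    · linarith [hζ.1]
    · linarith [hζ.2]
  obtain ⟨f, hf0, hf1, -⟩ := exists_contMDiffMap_zero_one_of_isClosed
    (modelWithCornersSelf ℝ (EuclideanSpace ℝ (Fin d))) (n := (⊤ : ℕ∞)) hU.isClosed_compl hK hdisj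
  refine ⟨fun ζ => (f ζ : ℂ), ⟨Complex.ofRealCLM.contDiff.comp f.contMDiff.contDiff, ?_⟩,
    fun ζ hζ => ?_⟩
  · refine closure_minimal ?_ isCompact_amplitude_support.isClosed
    intro ζ hζ
    by_contra hc
    refine hζ ?_
    have : f ζ = 0 := hf0 fun h => hc ⟨h.1.le, h.2.le⟩
    simp [this]
  · have : f ζ = 1 := hf1 hζ
    simp [this]

end WaveSum

/-! ### Maximal bounds for families of localized waves. -/

section Weighted

variable {d : ℕ} {α γ s : ℝ}

/-- Time translation preserves the norm and the support of `g`, so a cover by translates of `(0, N ^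
α]` costs only their number. -/
lemma LocalMaximalBound.symmetric_times {l : ℝ} {C : ℝ≥0} (hC : LocalMaximalBound d α γ s l C)
    (hα : 0 < α) (k : ℕ) {N : ℝ} (hN : 1 ≤ N) (y : EuclideanSpace ℝ (Fin d))
    {μ : Measure (EuclideanSpace ℝ (Fin d))} {D : ℝ} (hD : D ∈ ballConstants γ μ)
    {g : EuclideanSpace ℝ (Fin d) → ℂ} (hg : MemLp g 2 volume)
    (hgl : ∀ ζ, ζ ∉ annulus d l → g ζ = 0) :
    maximalSq α {t | |t| ≤ k * N ^ α} g (μ.restrict (ball y N)) ≤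
      ((2 * k + 1 : ℕ) * C : ℝ≥0) * (ENNReal.ofReal (N ^ (2 * s) * D) * sqNorm g) := by
  have ha : 0 < N ^ α := by positivity
  -- The translate of index `i` is `((i - k - 1) * N ^ α, (i - k) * N ^ α]`. Being open on the left,
  -- `2 * k` of them would miss `-k * N ^ α`, hence the extra one.
  have hsub : {t | |t| ≤ k * N ^ α} ⊆ ⋃ i ∈ Finset.range (2 * k + 1),
      (· + ((i : ℝ) - k - 1) * N ^ α) '' Set.Ioc 0 (N ^ α) := by
    intro t ht
    obtain ⟨h1, h2⟩ := abs_le.1 ht.out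
    have h3 : -(k : ℤ) ≤ ⌈t / N ^ α⌉ := by
      have : (-(k : ℤ) : ℝ) ≤ ⌈t / N ^ α⌉ := by
        refine le_trans ?_ (Int.le_ceil _)
        rw [le_div_iff₀ ha]
        push_cast
        linarith
      exact_mod_cast this
    have h4 : ⌈t / N ^ α⌉ ≤ (k : ℤ) := by
      rw [Int.ceil_le, div_le_iff₀ ha]
      exact_mod_cast h2
    obtain ⟨i, hi⟩ := Int.eq_ofNat_of_zero_le (by omega : 0 ≤ ⌈t / N ^ α⌉ + k)
    have hi' : (i : ℝ) - k = (⌈t / N ^ α⌉ : ℤ) := by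
      have : ((⌈t / N ^ α⌉ + k : ℤ) : ℝ) = (i : ℝ) := by rw [hi]; simp
      push_cast at this
      linarith
    have h5 := Int.le_ceil (t / N ^ α)
    have h6 := Int.ceil_lt_add_one (t / N ^ α)
    rw [div_le_iff₀ ha] at h5
    have h7 : (⌈t / N ^ α⌉ : ℝ) * N ^ α < t + N ^ α := by
      have := mul_lt_mul_of_pos_right h6 ha
      rwa [add_mul, div_mul_cancel₀ _ ha.ne', one_mul] at this
    simp only [Set.mem_iUnion, Finset.mem_range]
    refine ⟨i, by omega, t - ((i : ℝ) - k - 1) * N ^ α, ⟨?_, ?_⟩, by simp⟩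
    · rw [hi']; linarith
    · rw [hi']; linarith
  refine (maximalSq_mono hsub le_rfl).trans ?_
  refine (maximalSq_iUnion_le hα _ _ (integrable_of_vanish_off_annulus hg hgl) _).trans ?_
  refine (Finset.sum_le_card_nsmul _ _ (C * (ENNReal.ofReal (N ^ (2 * s) * D) * sqNorm g))
    fun i _ => ?_).trans_eq ?_
  · rw [← maximalSq_translate_time]
    refine (hC N hN y μ D hD _ (memLp_planeWave_mul hα _ _ hg) fun ζ hζ => ?_).trans_eq ?_
    · rw [hgl ζ hζ, mul_zero]
    · rw [sqNorm_planeWave_mul]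
  · rw [Finset.card_range, nsmul_eq_mul]
    push_cast
    ring

lemma sqNorm_mono {g h : EuclideanSpace ℝ (Fin d) → ℂ} (hgh : ∀ ζ, ‖g ζ‖ ≤ ‖h ζ‖) :
    sqNorm g ≤ sqNorm h :=
  lintegral_mono fun ζ => pow_le_pow_left' (enorm_le_iff_norm_le.2 (hgh ζ)) 2

/-- The times for which waves of unit frequency travel at most a distance `N`, within
`[-N ^ α, N ^ α]`. -/
def shortTimes (α N : ℝ) : Set ℝ := {t | |t| ≤ N ∧ |t| ≤ N ^ α}

/-- The shell `1/2 ≤ ‖ζ‖ ≤ 4`, which supports the amplitudes, is cut into the annuli at `l = 1/2, 1,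
2`. -/
lemma exists_maximalBound_of_support (hα : 0 < α)
    (hloc : ∀ l : ℝ, 1 / 2 ≤ l → ∃ C, LocalMaximalBound d α γ s l C) :
    ∃ C : ℝ≥0, ∀ N : ℝ, 1 ≤ N → ∀ (y : EuclideanSpace ℝ (Fin d))
      (μ : Measure (EuclideanSpace ℝ (Fin d))), ∀ D ∈ ballConstants γ μ,
      ∀ g : EuclideanSpace ℝ (Fin d) → ℂ, MemLp g 2 volume →
        (∀ ζ, ¬(1 / 2 ≤ ‖ζ‖ ∧ ‖ζ‖ ≤ 4) → g ζ = 0) →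
        maximalSq α (shortTimes α N) g (μ.restrict (ball y N)) ≤
          C * (ENNReal.ofReal (N ^ (2 * s) * D) * sqNorm g) := by
  obtain ⟨C₁, hC₁⟩ := hloc (1 / 2) le_rfl
  obtain ⟨C₂, hC₂⟩ := hloc 1 (by norm_num)
  obtain ⟨C₃, hC₃⟩ := hloc 2 (by norm_num)
  -- Each `3` is the number `2 * 1 + 1` of time translates, each `2` comes from `(a + b)² ≤ 2 (a² +
  -- b²)`.
  refine ⟨2 * (3 * C₁ + 2 * (3 * C₂ + 3 * C₃)), fun N hN y μ D hD g hg hgl => ?_⟩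
  have hsub : shortTimes α N ⊆ {t | |t| ≤ (1 : ℕ) * N ^ α} := fun t ht => by
    simpa using ht.2
  have piece : ∀ (l : ℝ) (C : ℝ≥0), LocalMaximalBound d α γ s l C →
      ∀ A : Set (EuclideanSpace ℝ (Fin d)), MeasurableSet A →
      (∀ ζ ∈ A, (1 / 2 ≤ ‖ζ‖ ∧ ‖ζ‖ ≤ 4) → ζ ∈ annulus d l) →
      Integrable (A.indicator g) ∧ maximalSq α (shortTimes α N) (A.indicator g)
        (μ.restrict (ball y N)) ≤ (3 * C) * (ENNReal.ofReal (N ^ (2 * s) * D) * sqNorm g) := by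
    intro l C hC A hA hAl
    have hv : ∀ ζ, ζ ∉ annulus d l → A.indicator g ζ = 0 := by
      intro ζ hζ
      by_cases h : ζ ∈ A
      · rw [Set.indicator_of_mem h]
        exact hgl ζ fun h' => hζ (hAl ζ h h')
      · exact Set.indicator_of_notMem h g
    refine ⟨integrable_of_vanish_off_annulus (hg.indicator hA) hv, ?_⟩
    refine (maximalSq_mono hsub le_rfl).trans
      ((hC.symmetric_times hα 1 hN y hD (hg.indicator hA) hv).trans ?_)
    have h3 : (((2 * 1 + 1 : ℕ) * C : ℝ≥0) : ℝ≥0∞) = 3 * C := by push_cast; norm_num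
    rw [h3]
    gcongr
    exact sqNorm_mono fun ζ => norm_indicator_le_norm_self _ _
  have m₁ : MeasurableSet {ζ : EuclideanSpace ℝ (Fin d) | ‖ζ‖ ≤ 1} :=
    measurableSet_le measurable_norm measurable_const
  have m₂ : MeasurableSet {ζ : EuclideanSpace ℝ (Fin d) | 1 < ‖ζ‖ ∧ ‖ζ‖ ≤ 2} :=
    (measurableSet_lt measurable_const measurable_norm).inter
      (measurableSet_le measurable_norm measurable_const)
  have m₃ : MeasurableSet {ζ : EuclideanSpace ℝ (Fin d) | 2 < ‖ζ‖} :=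
    measurableSet_lt measurable_const measurable_norm
  obtain ⟨i₁, b₁⟩ := piece _ _ hC₁ _ m₁ fun ζ h h' => ⟨h'.1, h.out.trans (by norm_num)⟩
  obtain ⟨i₂, b₂⟩ := piece _ _ hC₂ _ m₂ fun ζ h _ => ⟨h.out.1.le, h.out.2.trans (by norm_num)⟩
  obtain ⟨i₃, b₃⟩ := piece _ _ hC₃ _ m₃ fun ζ h h' => ⟨h.out.le, h'.2.trans (by norm_num)⟩
  have hdec : g = fun ζ => {ζ : EuclideanSpace ℝ (Fin d) | ‖ζ‖ ≤ 1}.indicator g ζ +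
      ({ζ : EuclideanSpace ℝ (Fin d) | 1 < ‖ζ‖ ∧ ‖ζ‖ ≤ 2}.indicator g ζ +
        {ζ : EuclideanSpace ℝ (Fin d) | 2 < ‖ζ‖}.indicator g ζ) := by
    funext ζ
    simp only [Set.indicator_apply, Set.mem_ofPred_eq]
    rcases le_or_gt ‖ζ‖ 1 with h1 | h1
    · have h2 : ¬ 1 < ‖ζ‖ := not_lt.2 h1
      have h3 : ¬ 2 < ‖ζ‖ := by linarith
      simp [h1, h2, h3]
    · rcases le_or_gt ‖ζ‖ 2 with h2 | h2
      · simp [h1, h2, not_le.2 h1, not_lt.2 h2]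
      · simp [h1, h2, not_le.2 h1, not_le.2 h2]
  conv_lhs => rw [hdec]
  refine (maximalSq_add_le hα i₁ (i₂.add i₃) _ _).trans ?_
  refine (mul_le_mul' le_rfl (add_le_add b₁ ((maximalSq_add_le hα i₂ i₃ _ _).trans
    (mul_le_mul' le_rfl (add_le_add b₂ b₃))))).trans_eq ?_
  push_cast
  ring

/-- The coefficients of a wave sum may depend on `x` and `t` without any measurability. A measurable
majorant `G` is therefore carried through the induction, so that integrals of sums can be split. -/
lemma IsWaveSum.exists_majorant {h : WaveParam d → SchwartzMap (EuclideanSpace ℝ (Fin d)) ℂ}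
    (hh : IsWaveSum α h) (hα : 0 < α)
    (hloc : ∀ l : ℝ, 1 / 2 ≤ l → ∃ C, LocalMaximalBound d α γ s l C) :
    ∃ C : ℝ≥0, ∀ N : ℝ, 1 ≤ N → ∀ (y : EuclideanSpace ℝ (Fin d))
      (μ : Measure (EuclideanSpace ℝ (Fin d))), ∀ D ∈ ballConstants γ μ, ∀ u : L2Space d,
      ∃ G : EuclideanSpace ℝ (Fin d) → ℝ≥0∞, Measurable G ∧
        (∀ x ∈ ball y N, ∀ t ∈ shortTimes α N, ‖∫ ζ, h ⟨N, y, x, t⟩ ζ * u ζ‖ₑ ^ 2 ≤ G x) ∧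
        ∫⁻ x in ball y N, G x ∂μ ≤ C * (ENNReal.ofReal (N ^ (2 * s) * D) * sqNorm u) := by
  induction hh with
  | term c B h hc hB hh =>
    obtain ⟨K, hK⟩ := hc
    obtain ⟨M, hM0, hM⟩ := hB.exists_bound
    obtain ⟨C, hC⟩ := exists_maximalBound_of_support (d := d) hα hloc
    refine ⟨K.toNNReal ^ 2 * (C * M.toNNReal ^ 2), fun N hN y μ D hD u => ?_⟩
    have hBu : MemLp (fun ζ => B ζ * u ζ) 2 volume := by
      refine ((Lp.memLp u).const_mul (M : ℂ)).of_le
        (hB.contDiff.continuous.aestronglyMeasurable.mul (Lp.aestronglyMeasurable u)) ?_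
      filter_upwards with ζ
      rw [norm_mul, norm_mul, Complex.norm_real, Real.norm_of_nonneg hM0]
      gcongr
      exact hM ζ
    have hv : ∀ ζ : EuclideanSpace ℝ (Fin d), ¬(1 / 2 ≤ ‖ζ‖ ∧ ‖ζ‖ ≤ 4) → B ζ * u ζ = 0 :=
      fun ζ hζ => by rw [hB.eq_zero hζ, zero_mul]
    have hint : Integrable fun ζ => B ζ * u ζ :=
      (hB.contDiff.continuous.memLp_of_hasCompactSupport hB.hasCompactSupport).integrable_mul
        (p := 2) (q := 2) (Lp.memLp u)
    have hm := measurable_iSup_extension hα hint (shortTimes α N)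
    refine ⟨fun x => (K.toNNReal : ℝ≥0∞) ^ 2 *
      (⨆ t ∈ shortTimes α N, ‖extension α (fun ζ => B ζ * u ζ) x t‖ₑ) ^ 2,
      hm.const_mul _, fun x hx t ht => ?_, ?_⟩
    · have he : ∫ ζ, h ⟨N, y, x, t⟩ ζ * u ζ = c ⟨N, y, x, t⟩ *
          extension α (fun ζ => B ζ * u ζ) x t := by
        rw [extension, ← integral_const_mul]
        congr 1
        funext ζ
        rw [hh]
        ring
      have hadm : (⟨N, y, x, t⟩ : WaveParam d).Admissible :=
        ⟨hN, by simpa [dist_eq_norm] using (mem_ball.1 hx).le, ht.1⟩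
      rw [he, enorm_mul, mul_pow]
      beta_reduce
      gcongr
      · rw [← ofReal_norm]
        exact ENNReal.ofReal_le_ofReal (hK _ hadm)
      · exact le_biSup (fun t => ‖extension α (fun ζ => B ζ * u ζ) x t‖ₑ) ht
    · rw [lintegral_const_mul _ hm]
      have hs : sqNorm (fun ζ => B ζ * u ζ) ≤ (M.toNNReal : ℝ≥0∞) ^ 2 * sqNorm u := by
        rw [sqNorm, sqNorm, ← lintegral_const_mul' _ _ (by simp)]
        refine lintegral_mono fun ζ => ?_
        rw [enorm_mul, mul_pow]
        gcongr
        rw [← ofReal_norm]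
        exact ENNReal.ofReal_le_ofReal (hM ζ)
      calc _ ≤ (K.toNNReal : ℝ≥0∞) ^ 2 * (C * (ENNReal.ofReal (N ^ (2 * s) * D) *
              sqNorm (fun ζ => B ζ * u ζ))) := by
            gcongr
            exact hC N hN y μ D hD _ hBu hv
        _ ≤ (K.toNNReal : ℝ≥0∞) ^ 2 * (C * (ENNReal.ofReal (N ^ (2 * s) * D) *
              ((M.toNNReal : ℝ≥0∞) ^ 2 * sqNorm u))) := by gcongr
        _ = _ := by push_cast; ring
  | add h₁ h₂ _ _ ih₁ ih₂ =>
    obtain ⟨C₁, hC₁⟩ := ih₁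
    obtain ⟨C₂, hC₂⟩ := ih₂
    refine ⟨2 * (C₁ + C₂), fun N hN y μ D hD u => ?_⟩
    obtain ⟨G₁, m₁, p₁, b₁⟩ := hC₁ N hN y μ D hD u
    obtain ⟨G₂, m₂, p₂, b₂⟩ := hC₂ N hN y μ D hD u
    have hint : ∀ h : SchwartzMap (EuclideanSpace ℝ (Fin d)) ℂ,
        Integrable fun ζ => h ζ * u ζ := fun h =>
      (h.memLp 2).integrable_mul (p := 2) (q := 2) (Lp.memLp u)
    refine ⟨fun x => 2 * (G₁ x + G₂ x), (m₁.add m₂).const_mul _, fun x hx t ht => ?_, ?_⟩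
    · have he : ∫ ζ, (h₁ ⟨N, y, x, t⟩ + h₂ ⟨N, y, x, t⟩) ζ * u ζ =
          (∫ ζ, h₁ ⟨N, y, x, t⟩ ζ * u ζ) + ∫ ζ, h₂ ⟨N, y, x, t⟩ ζ * u ζ := by
        rw [← integral_add (hint _) (hint _)]
        congr 1
        funext ζ
        rw [add_apply, add_mul]
      rw [he]
      refine (pow_le_pow_left' (enorm_add_le _ _) 2).trans ((add_sq_le_two_mul _ _).trans ?_)
      beta_reduce
      gcongr
      · exact p₁ x hx t ht
      · exact p₂ x hx t ht
    · rw [lintegral_const_mul (f := fun x => G₁ x + G₂ x) _ (m₁.add m₂), lintegral_add_left m₁]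
      refine (mul_le_mul' le_rfl (add_le_add b₁ b₂)).trans_eq ?_
      push_cast
      ring

end Weighted

/-! ### Localization by weights, and removal of the localization by averaging. -/

section Global

variable {d : ℕ} {α γ s : ℝ}

/-- The weight `(1 + |(z - y) / N|²)^{-m}`. -/
noncomputable def localWeight (m : ℕ) (N : ℝ) (y z : EuclideanSpace ℝ (Fin d)) : ℝ :=
  ((1 + ‖N⁻¹ • (z - y)‖ ^ 2) ^ m)⁻¹

lemma localWeight_pos (m : ℕ) (N : ℝ) (y z : EuclideanSpace ℝ (Fin d)) :
    0 < localWeight m N y z := by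
  unfold localWeight
  positivity

lemma localWeight_le_one (m : ℕ) (N : ℝ) (y z : EuclideanSpace ℝ (Fin d)) :
    localWeight m N y z ≤ 1 :=
  inv_le_one_of_one_le₀ (one_le_pow₀ (by nlinarith [sq_nonneg ‖N⁻¹ • (z - y)‖]))

lemma continuous_localWeight (m : ℕ) (N : ℝ) :
    Continuous fun p : EuclideanSpace ℝ (Fin d) × EuclideanSpace ℝ (Fin d) =>
      localWeight m N p.1 p.2 := by
  unfold localWeight
  exact Continuous.inv₀ (by fun_prop) fun p => by positivity

/-- For short times only the part of `f` near `ball y N` matters, up to tails of any prescribed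
polynomial order. -/
lemma exists_weightedBound (hα : 0 < α)
    (hloc : ∀ l : ℝ, 1 / 2 ≤ l → ∃ C, LocalMaximalBound d α γ s l C) (m : ℕ) :
    ∃ C : ℝ≥0, ∀ N : ℝ, 1 ≤ N → ∀ (y : EuclideanSpace ℝ (Fin d))
      (μ : Measure (EuclideanSpace ℝ (Fin d))), ∀ D ∈ ballConstants γ μ,
      ∀ f : L2Space d, (∀ᵐ ζ, ζ ∉ annulus d 1 → (𝓕 f : L2Space d) ζ = 0) →
        maximalSq α (shortTimes α N) (fun ζ => (𝓕 f : L2Space d) ζ) (μ.restrict (ball y N)) ≤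
          C * (ENNReal.ofReal (N ^ (2 * s) * D) *
            sqNorm fun z => (localWeight m N y z : ℂ) * f z) := by
  obtain ⟨B, hB, hB1⟩ := exists_isAmplitude_eq_one d
  have h0 : IsWaveSum α (amplitudeWave α hB) :=
    .term (fun _ => 1) B _ ⟨1, fun p _ => by simp⟩ hB fun p ζ => by
      rw [one_mul, amplitudeWave_apply]
  obtain ⟨C, hC⟩ := (h0.iterate_weightOperator m).exists_majorant hα hloc
  refine ⟨C, fun N hN y μ D hD f hf => ?_⟩
  have hN0 : N ≠ 0 := by linarith
  have hF : MemLp (fun z => (localWeight m N y z : ℂ) * f z) 2 volume := by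
    refine (Lp.memLp f).of_le ((Complex.continuous_ofReal.comp ((continuous_localWeight m N).comp
      (Continuous.prodMk_right y))).aestronglyMeasurable.mul (Lp.aestronglyMeasurable f)) ?_
    filter_upwards with z
    rw [norm_mul, Complex.norm_real, Real.norm_of_nonneg (localWeight_pos m N y z).le]
    exact mul_le_of_le_one_left (norm_nonneg _) (localWeight_le_one m N y z)
  obtain ⟨F, hFdef⟩ : ∃ F : L2Space d, F = hF.toLp := ⟨_, rfl⟩
  have hFae : F =ᵐ[volume] fun z => (localWeight m N y z : ℂ) * f z := by
    rw [hFdef]; exact hF.coeFn_toLp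
  obtain ⟨G, -, hG, hGb⟩ := hC N hN y μ D hD (𝓕 F)
  -- Pass to physical space, insert `1 = w⁻¹ w`, let `w` act on `f` and `w⁻¹` on the transform of
  -- the wave, and pass back. The cutoff `B` is free because it equals one on the support of the
  -- data.
  have key : ∀ x t, extension α (fun ζ => (𝓕 f : L2Space d) ζ) x t =
      ∫ ζ, ((weightOperator N y)^[m] (amplitudeWave α hB ⟨N, y, x, t⟩)) ζ *
        (𝓕 F : L2Space d) ζ := by
    intro x t
    have e1 : extension α (fun ζ => (𝓕 f : L2Space d) ζ) x t =
        ∫ ζ, amplitudeWave α hB ⟨N, y, x, t⟩ ζ * (𝓕 f : L2Space d) ζ := by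
      refine integral_congr_ae ?_
      filter_upwards [hf] with ζ hζ
      rw [amplitudeWave_apply]
      by_cases h : ζ ∈ annulus d 1
      · rw [hB1 ζ h, mul_one]
      · rw [hζ h, mul_zero, mul_zero]
    rw [e1, integral_schwartz_mul_fourier, integral_schwartz_mul_fourier]
    refine integral_congr_ae ?_
    filter_upwards [hFae] with z hz
    rw [hz, fourier_iterate_weightOperator hN0]
    have hw : (((1 + ‖N⁻¹ • (z - y)‖ ^ 2) ^ m : ℝ) : ℂ) * (localWeight m N y z : ℂ) = 1 := by
      rw [← Complex.ofReal_mul, localWeight, mul_inv_cancel₀ (by positivity), Complex.ofReal_one]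
    linear_combination -((𝓕 (amplitudeWave α hB ⟨N, y, x, t⟩)) z * f z) * hw
  have hnorm : sqNorm (fun ζ => (𝓕 F : L2Space d) ζ) =
      sqNorm fun z => (localWeight m N y z : ℂ) * f z := by
    have h1 : ENNReal.ofReal (‖(𝓕 F : L2Space d)‖ ^ 2) =
      sqNorm (fun ζ => (𝓕 F : L2Space d) ζ) := ofReal_norm_sq _
    rw [← h1, Lp.norm_fourier_eq, ofReal_norm_sq, sqNorm_congr hFae]
  rw [← hnorm]
  refine le_trans ?_ hGb
  refine setLIntegral_mono' measurableSet_ball fun x hx => ?_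
  have hsup : (⨆ t ∈ shortTimes α N, ‖extension α (fun ζ => (𝓕 f : L2Space d) ζ) x t‖ₑ) ≤
      G x ^ ((1 : ℝ) / 2) := by
    refine iSup₂_le fun t ht => ?_
    rw [key]
    refine le_of_eq_of_le ?_ (ENNReal.rpow_le_rpow (hG x hx t ht) (by norm_num : (0 : ℝ) ≤ 1 / 2))
    rw [← ENNReal.rpow_natCast, ← ENNReal.rpow_mul]
    norm_num
  refine (pow_le_pow_left' hsup 2).trans_eq ?_
  rw [← ENNReal.rpow_natCast, ← ENNReal.rpow_mul]
  norm_num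

lemma sigmaFinite_of_ballConstants {μ : Measure (EuclideanSpace ℝ (Fin d))} {D : ℝ}
    (hD : D ∈ ballConstants γ μ) : SigmaFinite μ := by
  have : IsLocallyFiniteMeasure μ :=
    ⟨fun x => ⟨ball x 1, ball_mem_nhds x one_pos,
      (hD.2 x 1 one_pos).trans_lt ENNReal.ofReal_lt_top⟩⟩
  infer_instance

/-- By Tonelli: each `x` lies in `ball y N` for a set of centres `y` of volume `N ^ d` times that of
the unit ball. -/
lemma lintegral_lintegral_ball {μ : Measure (EuclideanSpace ℝ (Fin d))} [SigmaFinite μ]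
    {G : EuclideanSpace ℝ (Fin d) → ℝ≥0∞} (hG : Measurable G) {N : ℝ} (hN : 0 < N) :
    ∫⁻ y, ∫⁻ x in ball y N, G x ∂μ =
      ENNReal.ofReal (N ^ d) * volume (ball (0 : EuclideanSpace ℝ (Fin d)) 1) * ∫⁻ x, G x ∂μ := by
  have hS : MeasurableSet {p : EuclideanSpace ℝ (Fin d) × EuclideanSpace ℝ (Fin d) |
      dist p.2 p.1 < N} := measurableSet_lt (by fun_prop) measurable_const
  have h1 : ∀ y, ∫⁻ x in ball y N, G x ∂μ = ∫⁻ x, {p : EuclideanSpace ℝ (Fin d) ×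
      EuclideanSpace ℝ (Fin d) | dist p.2 p.1 < N}.indicator (fun p => G p.2) (y, x) ∂μ := by
    intro y
    rw [← lintegral_indicator measurableSet_ball]
    rfl
  simp only [h1]
  rw [lintegral_lintegral_swap (f := fun y x => {p : EuclideanSpace ℝ (Fin d) ×
    EuclideanSpace ℝ (Fin d) | dist p.2 p.1 < N}.indicator (fun p => G p.2) (y, x))
    ((hG.comp measurable_snd).indicator hS).aemeasurable, ← lintegral_const_mul _ hG]
  refine lintegral_congr fun x => ?_
  have h2 : ∀ y, {p : EuclideanSpace ℝ (Fin d) × EuclideanSpace ℝ (Fin d) |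
      dist p.2 p.1 < N}.indicator (fun p => G p.2) (y, x) =
        (ball x N).indicator (fun _ => G x) y := by
    intro y
    by_cases h : dist y x < N
    · rw [Set.indicator_of_mem (mem_ball.2 h), Set.indicator_of_mem]
      exact (dist_comm x y).trans_lt h
    · rw [Set.indicator_of_notMem (mt mem_ball.1 h), Set.indicator_of_notMem]
      exact fun h' => h ((dist_comm y x).trans_lt h')
  simp only [h2]
  rw [lintegral_indicator_const measurableSet_ball, Measure.addHaar_ball_of_pos _ _ hN,
    finrank_euclideanSpace_fin, mul_comm]

lemma lintegral_sqNorm_localWeight (m : ℕ) {N : ℝ} (hN : 0 < N) (f : L2Space d) :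
    ∫⁻ y, sqNorm (fun z => (localWeight m N y z : ℂ) * f z) =
      ENNReal.ofReal (N ^ d) * (∫⁻ x : EuclideanSpace ℝ (Fin d),
        ENNReal.ofReal (((1 + ‖x‖ ^ 2) ^ m)⁻¹ ^ 2)) * sqNorm f := by
  have hw := (continuous_localWeight (d := d) m N).measurable
  have hf : AEMeasurable (fun p : EuclideanSpace ℝ (Fin d) × EuclideanSpace ℝ (Fin d) =>
      ‖f p.2‖ₑ) (volume.prod volume) :=
    ((Lp.stronglyMeasurable f).measurable.enorm.comp measurable_snd).aemeasurable
  unfold sqNorm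
  rw [lintegral_lintegral_swap]
  · rw [← lintegral_const_mul _ ((Lp.stronglyMeasurable f).measurable.enorm.pow_const 2)]
    refine lintegral_congr fun z => ?_
    have h1 : ∀ y, ‖(localWeight m N y z : ℂ) * f z‖ₑ ^ 2 =
        ENNReal.ofReal (localWeight m N y z ^ 2) * ‖f z‖ₑ ^ 2 := by
      intro y
      rw [enorm_mul, mul_pow, ← ofReal_norm (localWeight m N y z : ℂ), Complex.norm_real,
        Real.norm_of_nonneg (localWeight_pos m N y z).le,
        ENNReal.ofReal_pow (localWeight_pos m N y z).le]
    simp only [h1]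
    rw [lintegral_mul_const' _ _ (by simp)]
    congr 1
    have h2 : ∀ y, localWeight m N y z = ((1 + ‖N⁻¹ • (z - y)‖ ^ 2) ^ m)⁻¹ := fun y => rfl
    simp only [h2]
    rw [lintegral_sub_left_eq_self (μ := (volume : Measure (EuclideanSpace ℝ (Fin d))))
      (fun x => ENNReal.ofReal (((1 + ‖N⁻¹ • x‖ ^ 2) ^ m)⁻¹ ^ 2)) z]
    have h3 := (MeasurableEquiv.smul₀ N⁻¹ (inv_ne_zero hN.ne')).measurableEmbedding.lintegral_map
      (μ := (volume : Measure (EuclideanSpace ℝ (Fin d))))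
      (fun x => ENNReal.ofReal (((1 + ‖x‖ ^ 2) ^ m)⁻¹ ^ 2))
    simp only [MeasurableEquiv.coe_smul₀] at h3
    rw [← h3, Measure.map_addHaar_smul _ (inv_ne_zero hN.ne'), lintegral_smul_measure,
      smul_eq_mul, finrank_euclideanSpace_fin, inv_pow, inv_inv, abs_of_pos (by positivity)]
  · refine AEMeasurable.pow_const ?_ 2
    simp only [enorm_mul]
    exact (Complex.measurable_ofReal.comp hw).enorm.aemeasurable.mul hf

/-- The integrand decays like `‖x‖ ^ (-4 * (d + 1))`, faster than `‖x‖ ^ (-d)`. -/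
lemma lintegral_weight_lt_top (d : ℕ) :
    ∫⁻ x : EuclideanSpace ℝ (Fin d), ENNReal.ofReal (((1 + ‖x‖ ^ 2) ^ (d + 1))⁻¹ ^ 2) < ⊤ := by
  have h := integrable_rpow_neg_one_add_norm_sq (E := EuclideanSpace ℝ (Fin d))
    (μ := volume) (r := 4 * (d + 1)) (by rw [finrank_euclideanSpace_fin]; linarith)
  have h2 : ∀ x : EuclideanSpace ℝ (Fin d),
      ((1 : ℝ) + ‖x‖ ^ 2) ^ (-(4 * ((d : ℝ) + 1)) / 2) = ((1 + ‖x‖ ^ 2) ^ (d + 1))⁻¹ ^ 2 := by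
    intro x
    have hp : 0 ≤ 1 + ‖x‖ ^ 2 := by positivity
    rw [inv_pow, ← pow_mul, ← Real.rpow_natCast _ ((d + 1) * 2), ← Real.rpow_neg hp]
    congr 1
    push_cast
    ring
  simp only [h2] at h
  exact h.lintegral_lt_top

/-- The maximal estimate over short times, without localization in space. -/
lemma exists_globalBound (hα : 0 < α)
    (hloc : ∀ l : ℝ, 1 / 2 ≤ l → ∃ C, LocalMaximalBound d α γ s l C) :
    ∃ C : ℝ≥0, ∀ N : ℝ, 1 ≤ N → ∀ (μ : Measure (EuclideanSpace ℝ (Fin d))),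
      ∀ D ∈ ballConstants γ μ, ∀ g : EuclideanSpace ℝ (Fin d) → ℂ, MemLp g 2 volume →
        (∀ ζ, ζ ∉ annulus d 1 → g ζ = 0) →
        maximalSq α (shortTimes α N) g μ ≤ C * (ENNReal.ofReal (N ^ (2 * s) * D) * sqNorm g) := by
  obtain ⟨C, hC⟩ := exists_weightedBound hα hloc (d + 1)
  set I := ∫⁻ x : EuclideanSpace ℝ (Fin d), ENNReal.ofReal (((1 + ‖x‖ ^ 2) ^ (d + 1))⁻¹ ^ 2) with hI
  have hItop : I ≠ ⊤ := (lintegral_weight_lt_top d).ne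
  set V := volume (ball (0 : EuclideanSpace ℝ (Fin d)) 1) with hV
  have hV0 : V ≠ 0 := (measure_ball_pos _ _ one_pos).ne'
  have hVtop : V ≠ ⊤ := measure_ball_lt_top.ne
  refine ⟨V.toNNReal⁻¹ * (C * I.toNNReal), fun N hN μ D hD g hg hgl => ?_⟩
  have hN0 : 0 < N := by linarith
  have := sigmaFinite_of_ballConstants hD
  obtain ⟨f, hf⟩ : ∃ f : L2Space d, f = 𝓕⁻ hg.toLp := ⟨_, rfl⟩
  have hfg : (fun ζ => (𝓕 f : L2Space d) ζ) =ᵐ[volume] g := by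
    rw [hf, FourierTransform.fourier_fourierInv_eq]
    exact hg.coeFn_toLp
  have hnorm : sqNorm f = sqNorm g := by
    have h1 : ENNReal.ofReal (‖(𝓕 f : L2Space d)‖ ^ 2) =
      sqNorm (fun ζ => (𝓕 f : L2Space d) ζ) := ofReal_norm_sq _
    rw [← ofReal_norm_sq, ← Lp.norm_fourier_eq, h1, sqNorm_congr hfg]
  have hm := measurable_iSup_extension hα (integrable_of_vanish_off_annulus hg hgl) (shortTimes α N)
  have hpt : ∀ y, ∫⁻ x in ball y N, (⨆ t ∈ shortTimes α N, ‖extension α g x t‖ₑ) ^ 2 ∂μ ≤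
      C * (ENNReal.ofReal (N ^ (2 * s) * D) *
        sqNorm fun z => (localWeight (d + 1) N y z : ℂ) * f z) := by
    intro y
    have := hC N hN y μ D hD f (hfg.mono fun ζ hζ h => hζ.trans (hgl ζ h))
    rwa [maximalSq, extension_congr hfg] at this
  -- Integrating over the centre `y` produces a factor `N ^ d` on both sides, which cancels.
  have hint := lintegral_mono (μ := volume) hpt
  rw [lintegral_lintegral_ball hm hN0, lintegral_const_mul' _ _ ENNReal.coe_ne_top,
    lintegral_const_mul' _ _ ENNReal.ofReal_ne_top, lintegral_sqNorm_localWeight _ hN0,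
    hnorm] at hint
  have hNd0 : ENNReal.ofReal (N ^ d) ≠ 0 := by
    rw [ne_eq, ENNReal.ofReal_eq_zero, not_le]; positivity
  have hle : V * maximalSq α (shortTimes α N) g μ ≤
      C * I * (ENNReal.ofReal (N ^ (2 * s) * D) * sqNorm g) := by
    rw [← ENNReal.mul_le_mul_iff_right hNd0 ENNReal.ofReal_ne_top]
    convert hint using 1
    · rw [maximalSq]; ring
    · ring
  have h4 : maximalSq α (shortTimes α N) g μ ≤
      V⁻¹ * (C * I * (ENNReal.ofReal (N ^ (2 * s) * D) * sqNorm g)) := by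
    rw [← ENNReal.mul_le_mul_iff_right hV0 hVtop, ← mul_assoc V, ENNReal.mul_inv_cancel hV0 hVtop,
      one_mul]
    exact hle
  refine h4.trans_eq ?_
  have hV0' : V.toNNReal ≠ 0 := (ENNReal.toNNReal_ne_zero).2 ⟨hV0, hVtop⟩
  rw [ENNReal.coe_mul, ENNReal.coe_mul, ENNReal.coe_inv hV0', ENNReal.coe_toNNReal hVtop,
    ENNReal.coe_toNNReal hItop]
  ring

end Global

/-! ### Counting consequences of the weak `ℓ^r` condition. -/

section WeakEll

lemma MemWeakEll.exists_count_bound {r : ℝ} {t : ℕ → ℝ} (ht : MemWeakEll r t) :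
    ∃ K : ℝ≥0, ∀ δ : ℝ, 0 < δ → ∃ A : Finset ℕ, (∀ n, δ ≤ |t n| → n ∈ A) ∧
      (A.card : ℝ) * δ ^ r ≤ K := by
  lift (⨆ (δ : ℝ) (_ : 0 < δ), ENNReal.ofReal (δ ^ r) *
    (({n : ℕ | δ ≤ |t n|}.encard : ℕ∞) : ℝ≥0∞)) to ℝ≥0 using ne_of_lt ht with K hK
  refine ⟨K, fun δ hδ => ?_⟩
  have hle : ENNReal.ofReal (δ ^ r) * (({n : ℕ | δ ≤ |t n|}.encard : ℕ∞) : ℝ≥0∞) ≤ K := by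
    rw [hK]
    exact le_iSup₂ (f := fun (δ : ℝ) (_ : 0 < δ) =>
      ENNReal.ofReal (δ ^ r) * (({n : ℕ | δ ≤ |t n|}.encard : ℕ∞) : ℝ≥0∞)) δ hδ
  have hpos : 0 < δ ^ r := Real.rpow_pos_of_pos hδ r
  have hfin : {n : ℕ | δ ≤ |t n|}.Finite := by
    by_contra hinf
    rw [Set.Infinite.encard_eq hinf, ENat.toENNReal_top, ENNReal.mul_top
      (by rw [ne_eq, ENNReal.ofReal_eq_zero, not_le]; exact hpos)] at hle
    exact absurd hle (by simp)
  refine ⟨hfin.toFinset, fun n hn => hfin.mem_toFinset.2 hn, ?_⟩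
  rw [hfin.encard_eq_coe_toFinset_card] at hle
  have h2 := ENNReal.toReal_mono ENNReal.coe_ne_top hle
  rw [ENNReal.toReal_mul, ENNReal.toReal_ofReal hpos.le] at h2
  simpa [mul_comm] using h2

lemma MemWeakEll.exists_abs_le {r : ℝ} (hr : 0 < r) {t : ℕ → ℝ} (ht : MemWeakEll r t) :
    ∃ k : ℕ, ∀ n, |t n| ≤ k := by
  obtain ⟨K, hK⟩ := ht.exists_count_bound
  have hpos : (0 : ℝ) < (K : ℝ) + 1 := by positivity
  -- At this level `δ ^ r = K + 1`, so even one index with `|t n| ≥ δ` would violate the count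
  -- bound.
  obtain ⟨A, hA, hc⟩ := hK (((K : ℝ) + 1) ^ r⁻¹) (by positivity)
  obtain ⟨k, hk⟩ := exists_nat_ge (((K : ℝ) + 1) ^ r⁻¹)
  refine ⟨k, fun n => ?_⟩
  by_contra hn
  have hmem := hA n (hk.trans (not_le.1 hn).le)
  have h1 : (1 : ℝ) ≤ A.card := by exact_mod_cast Finset.card_pos.2 ⟨n, hmem⟩
  rw [← Real.rpow_mul hpos.le, inv_mul_cancel₀ hr.ne', Real.rpow_one] at hc
  nlinarith

end WeakEll

/-! ### Maximal estimates along the sequence, and the return to frequency `R`. -/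

section Sequence

variable {d : ℕ} {α γ s : ℝ}

lemma planeWave_zero_zero (ζ : EuclideanSpace ℝ (Fin d)) : planeWave α 0 0 ζ = 1 := by
  simp [planeWave]

/-- The sequential maximal estimate with the exponent of the full maximal estimate. -/
lemma exists_sequenceBound_of_bounded (hα : 0 < α)
    (hloc : ∀ l : ℝ, 1 / 2 ≤ l → ∃ C, LocalMaximalBound d α γ s l C) {t : ℕ → ℝ} {k : ℕ}
    (hk : ∀ n, |t n| ≤ k) :
    ∃ C : ℝ≥0, ∀ R : ℝ, 1 ≤ R → ∀ (μ : Measure (EuclideanSpace ℝ (Fin d))),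
      ∀ D ∈ ballConstants γ μ, ∀ g : EuclideanSpace ℝ (Fin d) → ℂ, MemLp g 2 volume →
        (∀ ζ, ζ ∉ annulus d 1 → g ζ = 0) →
        maximalSq α (Set.range fun n => R ^ α * t n) g (μ.restrict (ball 0 R)) ≤
          C * (ENNReal.ofReal (R ^ (2 * s) * D) * sqNorm g) := by
  obtain ⟨C, hC⟩ := hloc 1 (by norm_num)
  refine ⟨(2 * k + 1 : ℕ) * C, fun R hR μ D hD g hg hgl => ?_⟩
  refine le_trans (maximalSq_mono ?_ le_rfl) (hC.symmetric_times hα k hR 0 hD hg hgl)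
  rintro _ ⟨n, rfl⟩
  have hRα : 0 < R ^ α := by positivity
  change |R ^ α * t n| ≤ k * R ^ α
  rw [abs_mul, abs_of_pos hRα, mul_comm]
  gcongr
  exact hk n

/-- The sequential maximal estimate with the improved exponent `κ s`. -/
lemma exists_sequenceBound_of_weakEll (hα : 0 < α) {r : ℝ} (hr : 0 < r) (hs : 0 < s)
    (hloc : ∀ l : ℝ, 1 / 2 ≤ l → ∃ C, LocalMaximalBound d α γ s l C) {t : ℕ → ℝ}
    (ht : MemWeakEll r t) {κ : ℝ} (hκ : κ = r * α / (r * min α 1 + 2 * s)) :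
    ∃ C : ℝ≥0, ∀ R : ℝ, 1 ≤ R → ∀ (μ : Measure (EuclideanSpace ℝ (Fin d))),
      ∀ D ∈ ballConstants γ μ, ∀ g : EuclideanSpace ℝ (Fin d) → ℂ, MemLp g 2 volume →
        (∀ ζ, ζ ∉ annulus d 1 → g ζ = 0) →
        maximalSq α (Set.range fun n => R ^ α * t n) g μ ≤
          C * (ENNReal.ofReal (R ^ (2 * (κ * s)) * D) * sqNorm g) := by
  obtain ⟨K, hK⟩ := ht.exists_count_bound
  obtain ⟨C, hC⟩ := exists_globalBound (d := d) hα hloc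
  have hmin : 0 < min α 1 := lt_min hα one_pos
  have hκ0 : 0 < κ := by rw [hκ]; positivity
  -- The balance that determines `κ`: at the threshold `|t n| = R ^ (-(2 * κ * s / r))` the rescaled
  -- time is exactly the largest short time for `N = R ^ κ`.
  have hexp : α + -(2 * κ * s / r) = κ * min α 1 := by
    have : κ * (r * min α 1 + 2 * s) = r * α := by
      rw [hκ]; field_simp
    field_simp
    linarith
  refine ⟨C + K * C, fun R hR μ D hD g hg hgl => ?_⟩
  have hR0 : 0 < R := by linarith
  obtain ⟨A, hA, hcard⟩ := hK (R ^ (-(2 * κ * s / r))) (by positivity)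
  have hcard' : (A.card : ℝ) ≤ K * R ^ (2 * (κ * s)) := by
    rw [← Real.rpow_mul hR0.le, show -(2 * κ * s / r) * r = -(2 * (κ * s)) by field_simp,
      Real.rpow_neg hR0.le, ← div_eq_mul_inv, div_le_iff₀ (by positivity)] at hcard
    exact hcard
  -- The index `none` stands for the block of short times, `some n` for an exceptional single time.
  have hsub : (Set.range fun n => R ^ α * t n) ⊆ ⋃ i ∈ Finset.insertNone A,
      (i.elim (shortTimes α (R ^ κ)) fun n => {R ^ α * t n} : Set ℝ) := by
    rintro _ ⟨n, rfl⟩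
    simp only [Set.mem_iUnion]
    by_cases hn : n ∈ A
    · exact ⟨some n, by simpa using hn, by simp⟩
    · refine ⟨none, by simp, ?_⟩
      have hlt : |t n| ≤ R ^ (-(2 * κ * s / r)) := by
        by_contra h
        exact hn (hA n (not_le.1 h).le)
      have habs : |R ^ α * t n| ≤ R ^ (κ * min α 1) := by
        rw [abs_mul, abs_of_pos (by positivity : 0 < R ^ α), ← hexp, Real.rpow_add hR0]
        gcongr
      refine ⟨habs.trans (Real.rpow_le_rpow_of_exponent_le hR ?_), habs.trans ?_⟩
      · exact mul_le_of_le_one_right hκ0.le (min_le_right _ _)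
      · rw [← Real.rpow_mul hR0.le]
        exact Real.rpow_le_rpow_of_exponent_le hR
          (mul_le_mul_of_nonneg_left (min_le_left _ _) hκ0.le)
  -- A single time can be translated to `0`, where the global bound with `N = 1` applies without any
  -- power of `R`.
  have hsingle : ∀ τ : ℝ, maximalSq α {τ} g μ ≤ C * (ENNReal.ofReal D * sqNorm g) := by
    intro τ
    have h1 : ({τ} : Set ℝ) = (· + τ) '' {0} := by simp
    rw [h1, ← maximalSq_translate_time]
    refine (maximalSq_mono (T' := shortTimes α 1) ?_ le_rfl).trans
      ((hC 1 le_rfl μ D hD _ (memLp_planeWave_mul hα _ _ hg) fun ζ hζ => ?_).trans_eq ?_)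
    · rintro _ rfl
      constructor <;> simp
    · rw [hgl ζ hζ, mul_zero]
    · rw [sqNorm_planeWave_mul, Real.one_rpow, one_mul]
  refine (maximalSq_mono hsub le_rfl).trans ((maximalSq_iUnion_le hα _ _
    (integrable_of_vanish_off_annulus hg hgl) _).trans ?_)
  rw [Finset.sum_insertNone]
  simp only [Option.elim_none, Option.elim_some]
  have hshort := hC (R ^ κ) (Real.one_le_rpow hR hκ0.le) μ D hD g hg hgl
  rw [← Real.rpow_mul hR0.le, show κ * (2 * s) = 2 * (κ * s) by ring] at hshort
  have hsum : ∑ n ∈ A, maximalSq α {R ^ α * t n} g μ ≤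
      (K * C) * (ENNReal.ofReal (R ^ (2 * (κ * s)) * D) * sqNorm g) := by
    refine (Finset.sum_le_card_nsmul _ _ _ fun n _ => hsingle _).trans ?_
    have hc : (A.card : ℝ≥0∞) ≤ K * ENNReal.ofReal (R ^ (2 * (κ * s))) := by
      have := ENNReal.ofReal_le_ofReal hcard'
      rwa [ENNReal.ofReal_natCast, ENNReal.ofReal_mul (by positivity),
        ENNReal.ofReal_coe_nnreal] at this
    rw [nsmul_eq_mul, ENNReal.ofReal_mul (by positivity)]
    calc _ ≤ (K * ENNReal.ofReal (R ^ (2 * (κ * s)))) * (C * (ENNReal.ofReal D * sqNorm g)) := by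
          gcongr
      _ = _ := by ring
  refine (add_le_add hshort hsum).trans_eq ?_
  push_cast
  ring

/-- Rescaling a sequential maximal estimate at unit frequency to frequencies of size `R`. -/
lemma maximalNorm_le_of_sequenceBound (hα : 0 < α) (hγd : γ ≤ d) {t : ℕ → ℝ} {σ : ℝ} {C : ℝ≥0}
    (hC : ∀ R : ℝ, 1 ≤ R → ∀ (μ : Measure (EuclideanSpace ℝ (Fin d))),
      ∀ D ∈ ballConstants γ μ, ∀ g : EuclideanSpace ℝ (Fin d) → ℂ, MemLp g 2 volume →
        (∀ ζ, ζ ∉ annulus d 1 → g ζ = 0) →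
        maximalSq α (Set.range fun n => R ^ α * t n) g (μ.restrict (ball 0 R)) ≤
          C * (ENNReal.ofReal (R ^ (2 * σ) * D) * sqNorm g))
    {R : ℝ} (hR : 1 ≤ R) {μ : Measure (EuclideanSpace ℝ (Fin d))} (hμ : IsDimensional γ μ)
    {f : L2Space d} (hf : FourierSupportedIn f R) :
    maximalNorm α t f μ ≤ ENNReal.ofReal ((Real.sqrt C + 1) * R ^ (((d : ℝ) - γ) / 2 + σ) *
      dimConst γ μ ^ ((1 : ℝ) / 2) * ‖f‖) := by
  have hR0 : 0 < R := by linarith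
  -- With `2 * π * N = R` the rescaled times are exactly `R ^ α * t n` and the frequencies lie in
  -- `annulus d 1`. As `N` may be less than one, the bound is applied on the larger ball of radius
  -- `R`.
  obtain ⟨N, hN⟩ : ∃ N, N = R / (2 * Real.pi) := ⟨_, rfl⟩
  have hN0 : 0 < N := by rw [hN]; positivity
  have hRN : 2 * Real.pi * N = R := by rw [hN]; field_simp
  have hNR : N ≤ R := by rw [← hRN]; nlinarith [Real.pi_gt_three]
  have hD := dimConst_mem hμ
  set D := dimConst γ μ with hDdef
  have hD0 : 0 ≤ D := hD.1
  set ν := μ.map (toUnitBall 0 N⁻¹) with hν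
  have hDν : D * N⁻¹ ^ γ ∈ ballConstants γ ν := ballConstants_map_toUnitBall hD 0 (inv_pos.2 hN0)
  have hback : ν.map (toUnitBall 0 N) = μ := by
    rw [hν, Measure.map_map (measurable_toUnitBall _ _) (measurable_toUnitBall _ _)]
    have : toUnitBall (0 : EuclideanSpace ℝ (Fin d)) N ∘ toUnitBall 0 N⁻¹ = id := by
      funext z
      simp [toUnitBall, smul_smul, hN0.ne']
    rw [this, Measure.map_id]
  have hann : MeasurableSet (annulus d 1) :=
    (measurableSet_le measurable_const measurable_norm).inter
      (measurableSet_le measurable_norm measurable_const)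
  -- The indicator turns almost everywhere vanishing off the annulus into vanishing everywhere.
  set g : EuclideanSpace ℝ (Fin d) → ℂ :=
    (annulus d 1).indicator fun η => (𝓕 f : L2Space d) (N • η) with hg
  have hgm : MemLp g 2 volume := (memLp_comp_smul (Lp.memLp _) hN0.ne').indicator hann
  have hgl : ∀ ζ, ζ ∉ annulus d 1 → g ζ = 0 := fun ζ hζ => Set.indicator_of_notMem hζ _
  have hfg : (fun η => (𝓕 f : L2Space d) (N • η)) =ᵐ[volume]
      fun η => planeWave α 0 0 η * g η := by
    filter_upwards [(Measure.quasiMeasurePreserving_smul volume hR0.ne').ae hf] with η hη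
    rw [planeWave_zero_zero, one_mul, hg]
    by_cases h : η ∈ annulus d 1
    · rw [Set.indicator_of_mem h]
    · rw [Set.indicator_of_notMem h]
      have h1 := hη fun h' => h ((smul_mem_annulus_iff hR0 1 η).1 (by rwa [mul_one]))
      rw [fourierHat, smul_smul, ← hRN] at h1
      rwa [inv_mul_cancel_left₀ (by positivity)] at h1
  have hnorm : ENNReal.ofReal (N ^ d) * sqNorm g = ENNReal.ofReal (‖f‖ ^ 2) := by
    have h3 := sqNorm_comp_smul (fun ζ => (𝓕 f : L2Space d) ζ) hN0
    have h4 : ENNReal.ofReal (‖(𝓕 f : L2Space d)‖ ^ 2) =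
        sqNorm (fun ζ => (𝓕 f : L2Space d) ζ) := ofReal_norm_sq _
    rw [← Lp.norm_fourier_eq f, h4, ← h3, sqNorm_congr hfg, sqNorm_planeWave_mul]
  have key := hC R hR ν _ hDν g hgm hgl
  have hsq : maximalNorm α t f μ ^ 2 ≤ ENNReal.ofReal ((Real.sqrt C + 1) *
      R ^ (((d : ℝ) - γ) / 2 + σ) * D ^ ((1 : ℝ) / 2) * ‖f‖) ^ 2 := by
    rw [sq_maximalNorm]
    conv_lhs => rw [← hback]
    rw [lintegral_iSup_schrodinger t f g hα 0 hN0 (integrable_of_vanish_off_annulus hgm hgl) hfg,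
      hRN]
    have hmono := maximalSq_mono (α := α) (g := g)
      (Set.Subset.refl (Set.range fun n => R ^ α * t n))
      (Measure.restrict_mono_set ν (ball_subset_ball (x := (0 : EuclideanSpace ℝ (Fin d))) hNR))
    calc _ ≤ ENNReal.ofReal (N ^ d) ^ 2 *
          (C * (ENNReal.ofReal (R ^ (2 * σ) * (D * N⁻¹ ^ γ)) * sqNorm g)) := by
          gcongr
          exact hmono.trans key
      _ = ENNReal.ofReal (N ^ d) * C * ENNReal.ofReal (R ^ (2 * σ) * (D * N⁻¹ ^ γ)) *
          (ENNReal.ofReal (N ^ d) * sqNorm g) := by ring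
      _ = ENNReal.ofReal (N ^ d * C * (R ^ (2 * σ) * (D * N⁻¹ ^ γ)) * ‖f‖ ^ 2) := by
          rw [hnorm, ← ENNReal.ofReal_coe_nnreal (p := C), ← ENNReal.ofReal_mul (by positivity),
            ← ENNReal.ofReal_mul (by positivity), ← ENNReal.ofReal_mul (by positivity)]
      _ ≤ ENNReal.ofReal (((Real.sqrt C + 1) *
            R ^ (((d : ℝ) - γ) / 2 + σ) * D ^ ((1 : ℝ) / 2) * ‖f‖) ^ 2) := by
          refine ENNReal.ofReal_le_ofReal ?_
          have e1 : (R ^ (((d : ℝ) - γ) / 2 + σ)) ^ 2 = R ^ ((d : ℝ) - γ) * R ^ (2 * σ) := by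
            rw [← Real.rpow_natCast (_ ^ _), ← Real.rpow_mul hR0.le, ← Real.rpow_add hR0]
            congr 1
            push_cast
            ring
          have e2 : (D ^ ((1 : ℝ) / 2)) ^ 2 = D := by
            rw [← Real.sqrt_eq_rpow, Real.sq_sqrt hD0]
          have e3 : N ^ d * N⁻¹ ^ γ = N ^ ((d : ℝ) - γ) := by
            rw [Real.inv_rpow hN0.le, ← Real.rpow_neg hN0.le, ← Real.rpow_natCast,
              ← Real.rpow_add hN0, sub_eq_add_neg]
          -- This is where `γ ≤ d` enters.
          have e4 : N ^ ((d : ℝ) - γ) ≤ R ^ ((d : ℝ) - γ) :=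
            Real.rpow_le_rpow hN0.le hNR (sub_nonneg.2 hγd)
          have e5 : (C : ℝ) ≤ (Real.sqrt C + 1) ^ 2 := by
            nlinarith [Real.sq_sqrt C.coe_nonneg, Real.sqrt_nonneg C]
          rw [mul_pow, mul_pow, mul_pow, e1, e2]
          calc N ^ d * C * (R ^ (2 * σ) * (D * N⁻¹ ^ γ)) * ‖f‖ ^ 2
              = C * ((N ^ d * N⁻¹ ^ γ) * R ^ (2 * σ)) * D * ‖f‖ ^ 2 := by ring
            _ ≤ _ := by
              rw [e3]
              gcongr
      _ = _ := ENNReal.ofReal_pow (by positivity) 2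
  have h2 : (0 : ℝ) < 2 := two_pos
  rw [← ENNReal.rpow_natCast, ← ENNReal.rpow_natCast] at hsq
  exact (ENNReal.rpow_le_rpow_iff (by norm_num)).1 hsq

end Sequence

theorem proposition3p1 (d : ℕ) (α γ r sStar : ℝ) (hα : 0 < α) (hγ : 0 < γ) (hγd : γ ≤ d)
    (hr : 0 < r) (hs : 0 < sStar)
    (hmax : ∃ C : ℝ, 0 < C ∧ ∀ R : ℝ, 1 ≤ R →
      ∀ μ : Measure (EuclideanSpace ℝ (Fin d)), IsDimensional γ μ →
      ∀ f : L2Space d, FourierSupportedIn f R →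
        maximalNorm α (fun t : Set.Ioc (0 : ℝ) 1 => (t : ℝ)) f μ ≤
          ENNReal.ofReal
            (C * R ^ (((d : ℝ) - γ) / 2 + sStar) * dimConst γ μ ^ ((1 : ℝ) / 2) * ‖f‖))
    (t : ℕ → ℝ) (ht : MemWeakEll r t) :
    ∃ C : ℝ, 0 < C ∧
      ∀ s : ℝ, min sStar (r * α / (r * min α 1 + 2 * sStar) * sStar) ≤ s →
      ∀ R : ℝ, 1 ≤ R →
      ∀ μ : Measure (EuclideanSpace ℝ (Fin d)), IsDimensional γ μ →
      ∀ f : L2Space d, FourierSupportedIn f R →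
        maximalNorm α t f μ ≤
          ENNReal.ofReal
            (C * R ^ (((d : ℝ) - γ) / 2 + s) * dimConst γ μ ^ ((1 : ℝ) / 2) * ‖f‖) := by
  have hloc : ∀ l : ℝ, 1 / 2 ≤ l → ∃ C, LocalMaximalBound d α γ sStar l C := fun l hl =>
    exists_localMaximalBound hα hmax (by nlinarith [Real.pi_gt_three])
  have hbound : ∃ C : ℝ≥0, ∀ R : ℝ, 1 ≤ R → ∀ (μ : Measure (EuclideanSpace ℝ (Fin d))),
      ∀ D ∈ ballConstants γ μ, ∀ g : EuclideanSpace ℝ (Fin d) → ℂ, MemLp g 2 volume →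
        (∀ ζ, ζ ∉ annulus d 1 → g ζ = 0) →
        maximalSq α (Set.range fun n => R ^ α * t n) g (μ.restrict (ball 0 R)) ≤
          C * (ENNReal.ofReal (R ^ (2 * min sStar
            (r * α / (r * min α 1 + 2 * sStar) * sStar)) * D) * sqNorm g) := by
    rcases min_choice sStar (r * α / (r * min α 1 + 2 * sStar) * sStar) with h | h
    · rw [h]
      obtain ⟨k, hk⟩ := ht.exists_abs_le hr
      exact exists_sequenceBound_of_bounded hα hloc hk
    · rw [h]
      obtain ⟨C, hC⟩ := exists_sequenceBound_of_weakEll (d := d) hα hr hs hloc ht rfl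
      exact ⟨C, fun R hR μ D hD g hg hgl =>
        -- The improved bound holds on the whole space, hence on the ball.
        (maximalSq_mono subset_rfl Measure.restrict_le_self).trans (hC R hR μ D hD g hg hgl)⟩
  obtain ⟨C, hC⟩ := hbound
  -- Adding `1` keeps the constant positive when `C = 0`. It does not depend on `s`, since larger
  -- `s` only increases the power of `R ≥ 1`.
  refine ⟨Real.sqrt C + 1, by positivity, fun s hs' R hR μ hμ f hf => ?_⟩
  refine (maximalNorm_le_of_sequenceBound hα hγd hC hR hμ hf).trans (ENNReal.ofReal_le_ofReal ?_)
  have := dimConst_nonneg (γ := γ) μ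
  gcongr
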